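/- **Setting.** For $t>0$ let $\mathrm{PW}_t$ be the Paley–Wiener space of entire functions $f(z)=\frac1{\sqrt{2\pi}}\int_{-t}^{t}\psi(\xi)e^{-i\xi z}\,d\xi$, $\psi\in L^2[-t,t]$, with the scalar product of $L^2(\mathbb R)$. A positive measure $\nu$ on $\mathbb R$ is PW-sampling if for every $t>0$ the norms of $L^2(\nu)$ and $L^2(\mathbb R)$ are equivalent on $\mathrm{PW}_t$. For such $\nu$ the truncated Toeplitz operator $L_{\nu,t}:\mathrm{PW}_t\to\mathrm{PW}_t$, $(L_{\nu,t}f,g)_{L^2(\mathbb R)}=\int f\bar g\,d\nu$ for all $f,g\in \mathrm{PW}_t$, is well defined and invertible, and one puts $$k_t=L_{\nu,t}^{-1}\Big[\tfrac{\sin tz}{\pi z}\Big]\in\mathrm{PW}_t,\qquad h^\nu(t)=\pi\,\frac{d}{dt}k_t(0).$$ Let $M^+(\mathbb T)$ be the set of finite positive Borel measures on the unit circle $\mathbb T$ with infinite support. A measure $\mu\in M^+(\mathbb T)$ is identified with the $2\pi$-periodic measure on $\mathbb R$ whose restriction to $[0,2\pi)$ is carried to $\mu$ by $x\mapsto e^{ix}$.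 The orthonormal polynomials of $\mu$ are polynomials $\phi_n$, $\deg\phi_n=n$, $n\ge0$, orthonormal with respect to $(p,q)=\frac1{2\pi}\int_{\mathbb T}p\,\bar q\,d\mu$ (so that $\phi_n(z)=z^n$ for Lebesgue measure $dx$). For $\eta\in\mathbb T$ let $\mu^{(\eta)}(\zeta)=\mu(\eta\zeta)$, that is, $\mu^{(\eta)}(E)=\mu(\eta E)$ for Borel sets $E\subset\mathbb T$. **Theorem.** Let $\mu\in M^+(\mathbb T)$ and let $\{\phi_n\}_{n\ge 0}$ be its orthonormal polynomials. Then, as measures on $\mathbb R$, $\mu$ and all $\mu^{(\eta)}$, $\eta\in\mathbb T$, are PW-sampling (so that $L_{\nu,t}$ and $k_t$ are well defined for these measures $\nu$ and all $t>0$), and for every $n\ge0$ the function $t\mapsto k_t(0)$ of each of them is differentiable on $\left(\frac n2,\frac{n+1}2\right)$. For every $n\ge 0$ and every $t\in\left(\frac n2,\frac{n+1}2\right)$, $$h^\mu(t)=|\phi_n(1)|^2,\qquad\text{and, for every }\eta\in\mathbb T,\qquad h^{\mu^{(\eta)}}(t)=|\phi_n(\eta)|^2 .$$ -/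

import Mathlib

open MeasureTheory Set
open scoped NNReal ComplexConjugate

noncomputable section

/-- The Paley–Wiener space `PW_t`: the image of `L²[-t, t]` under the Fourier transform
`ψ ↦ (2π)^{-1/2} ∫ ψ(ξ) e^{-iξz} dξ`, regarded as a space of entire functions. -/
def paleyWiener (t : ℝ) : Submodule ℂ (ℂ → ℂ) where
  carrier := {f | ∃ ψ : ℝ → ℂ, MemLp ψ 2 (volume.restrict (Icc (-t) t)) ∧
    ∀ z : ℂ, f z = ((Real.sqrt (2 * Real.pi) : ℝ) : ℂ)⁻¹ *
      ∫ ξ in Icc (-t) t, Complex.exp (-Complex.I * ξ * z) * ψ ξ}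
  zero_mem' := ⟨0, MemLp.zero, fun z => by simp⟩
  smul_mem' := by
    rintro c f ⟨ψ, hψ, hf⟩
    refine ⟨fun ξ => c * ψ ξ, hψ.const_mul c, fun z => ?_⟩
    have h : ∀ ξ : ℝ, Complex.exp (-Complex.I * ξ * z) * (c * ψ ξ) =
        c * (Complex.exp (-Complex.I * ξ * z) * ψ ξ) := fun ξ => by ring
    simp only [Pi.smul_apply, smul_eq_mul, hf z, h, integral_const_mul]
    ring
  add_mem' := by
    have key : ∀ (ψ : ℝ → ℂ), MemLp ψ 2 (volume.restrict (Icc (-t) t)) → ∀ z : ℂ,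
        IntegrableOn (fun ξ : ℝ => Complex.exp (-Complex.I * ξ * z) * ψ ξ) (Icc (-t) t) := by
      intro ψ hψ z
      have h1 : IntegrableOn ψ (Icc (-t) t) := hψ.integrable (by norm_num)
      exact h1.continuousOn_mul (by fun_prop) isCompact_Icc
    rintro f g ⟨ψ, hψ, hf⟩ ⟨χ, hχ, hg⟩
    refine ⟨fun ξ => ψ ξ + χ ξ, hψ.add hχ, fun z => ?_⟩
    simp only [Pi.add_apply, hf z, hg z, mul_add]
    rw [integral_add (key ψ hψ z) (key χ hχ z), mul_add]

/-- `∫ f ḡ dν` over the real line. -/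
def linePairing (ν : Measure ℝ) (f g : ℂ → ℂ) : ℂ :=
  ∫ x : ℝ, f (x : ℂ) * conj (g (x : ℂ)) ∂ν

/-- `ν` is PW-sampling: on every `PW_t` the norms of `L²(ν)` and of `L²(ℝ)` are equivalent. -/
def IsPWSampling (ν : Measure ℝ) : Prop :=
  ∀ t : ℝ, 0 < t → ∃ C : ℝ≥0, 0 < C ∧ ∀ f ∈ paleyWiener t,
    eLpNorm (fun x : ℝ => f (x : ℂ)) 2 volume ≤ C * eLpNorm (fun x : ℝ => f (x : ℂ)) 2 ν ∧
    eLpNorm (fun x : ℝ => f (x : ℂ)) 2 ν ≤ C * eLpNorm (fun x : ℝ => f (x : ℂ)) 2 volume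

/-- `L` is the truncated Toeplitz operator on `PW_t` with symbol `ν`: `PW_t ⊆ L²(ν)` and
`(L f, g)_{L²(ℝ)} = ∫ f ḡ dν` for all `f, g ∈ PW_t`. There is at most one such `L`. -/
def IsTruncatedToeplitz (ν : Measure ℝ) (t : ℝ) (L : paleyWiener t →ₗ[ℂ] paleyWiener t) : Prop :=
  (∀ f : paleyWiener t, MemLp (fun x : ℝ => (f : ℂ → ℂ) (x : ℂ)) 2 ν) ∧
  ∀ f g : paleyWiener t, linePairing volume (L f) g = linePairing ν f g

open Classical in
/-- The truncated Toeplitz operator `L_{ν,t}` (with value `0` if there is none). -/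
def truncatedToeplitz (ν : Measure ℝ) (t : ℝ) : paleyWiener t →ₗ[ℂ] paleyWiener t :=
  if h : ∃ L, IsTruncatedToeplitz ν t L then h.choose else 0

/-- The reproducing kernel of `PW_t` at the origin, `sin (t z) / (π z)`. -/
def sincKernel (t : ℝ) (z : ℂ) : ℂ :=
  if z = 0 then t / Real.pi else Complex.sin (t * z) / (Real.pi * z)

/-- `k_t = L_{ν,t}⁻¹ (sin (t z) / (π z))`, an element of `PW_t`; meaningful when `L_{ν,t}` is
invertible. -/
def reproKernel (ν : Measure ℝ) (t : ℝ) : paleyWiener t :=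
  Function.invFun (fun f : paleyWiener t => (truncatedToeplitz ν t f : ℂ → ℂ)) (sincKernel t)

/-- `k_t` is well defined for every `t > 0`: `L_{ν,t}` exists and is invertible, and
`L_{ν,t} k_t = sin (t z) / (π z)`. -/
def KernelsWellDefined (ν : Measure ℝ) : Prop :=
  ∀ t : ℝ, 0 < t → IsTruncatedToeplitz ν t (truncatedToeplitz ν t) ∧
    Function.Bijective (truncatedToeplitz ν t) ∧
    (truncatedToeplitz ν t (reproKernel ν t) : ℂ → ℂ) = sincKernel t

/-- The function `t ↦ k_t(0)`. -/
def kernelAtZero (ν : Measure ℝ) (t : ℝ) : ℂ :=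
  (reproKernel ν t : ℂ → ℂ) 0

/-- `h^ν(t) = π (d/dt) k_t(0)`. -/
def hFun (ν : Measure ℝ) (t : ℝ) : ℂ :=
  Real.pi * deriv (kernelAtZero ν) t

instance instMeasurableSpaceUnitCircle : MeasurableSpace Circle := borel Circle

instance instBorelSpaceUnitCircle : BorelSpace Circle := ⟨rfl⟩

/-- The `2π`-periodic measure on `ℝ` identified with the measure `μ` on the circle: its
restriction to a half-open interval of length `2π` is carried to `μ` by `x ↦ e^{ix}`. -/
def periodicMeasure (μ : Measure Circle) : Measure ℝ :=
  Measure.sum fun k : ℤ => μ.map fun z : Circle => Complex.arg (z : ℂ) + 2 * Real.pi * k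

/-- The shifted measure `μ^{(η)}(ζ) = μ(ηζ)`, i.e. `E ↦ μ(ηE)`. -/
def shiftMeasure (η : Circle) (μ : Measure Circle) : Measure Circle :=
  μ.map fun z : Circle => η⁻¹ * z

/-- `φ` is the family of orthonormal polynomials of `μ`: `φ n` has degree `n`, and the family is
orthonormal for `(p, q) = (2π)⁻¹ ∫ p q̄ dμ`. The factor matches the moments
`γ_k = (2π)⁻¹ ∫_{[0,2π)} e^{-ikx} dμ(x)`, for which Lebesgue measure `dx` has `φ n = z ^ n`. -/
def IsOrthonormalPolynomials (μ : Measure Circle) (φ : ℕ → Polynomial ℂ) : Prop :=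
  (∀ n : ℕ, (φ n).degree = n) ∧
  ∀ m n : ℕ, (2 * Real.pi : ℂ)⁻¹ *
    ∫ z : Circle, (φ m).eval (z : ℂ) * conj ((φ n).eval (z : ℂ)) ∂μ = if m = n then 1 else 0

end

/-! Write `ν` for the periodic measure, `f` and `g` in `PW_t` with Fourier data `ψ`, `χ`, and split
the frequencies into fibres `ξ + ℤ`, `0 ≤ ξ ≤ 1`. The values `f(x + 2πk)`, `k ∈ ℤ`, are, up to
`(2π)^{-1/2}`, the Fourier coefficients on `[0, 1]` of the sum of `e^{-iηx} ψ(η)` over the fibre.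
Parseval in `k` and integration in `x` over one period (`linePairing_periodization_eq_sum`) turn `∫
f ḡ dν` into an integral over `ξ` of Toeplitz forms in the fibre values of `ψ` and `χ`, with the
moments of `μ` as entries. Lebesgue measure is the case of the identity matrix. So `L_{ν,t}` acts
fibrewise as an `N × N` Toeplitz matrix, where `N` is the number of points of the fibre in `[-t,
t]`.

The orthonormal polynomials make these matrices uniformly positive definite for fixed `t`
(`exists_coercive`), which gives sampling and, by Lax–Milgram, invertibility. The function
`sin(tz)/(πz)` has constant Fourier data, so on each fibre `k_t` is, up to the same constant, the
solution of the Toeplitz system with right-hand side `(1, …, 1)`. By the reproducing property this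
solution consists of the conjugated coefficients of `∑_{k<N} conj(φ_k(1)) φ_k`
(`sum_toeplitzMoment_mul_cdCoeff`), and its entries add up to `∑_{k<N} |φ_k(1)|²`.

If `n/2 < t < (n+1)/2`, fibres have `n+1` points for a set of `ξ` of measure `2t - n` and `n` points
otherwise, up to a null set. Hence `2π k_t(0) = ∑_{k<n} |φ_k(1)|² + (2t - n)|φ_n(1)|²`, which is
affine in `t` with slope `2|φ_n(1)|²`. Rotating the circle moves the evaluation point from `1` to
`η`. -/

/-! ### Folding frequencies modulo 1 and Parseval on fibres -/

/-- The Paley–Wiener function with Fourier data `ψ`. -/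
noncomputable def pwTransform (t : ℝ) (ψ : ℝ → ℂ) (z : ℂ) : ℂ :=
  ((Real.sqrt (2 * Real.pi) : ℝ) : ℂ)⁻¹ *
    ∫ ξ in Icc (-t) t, Complex.exp (-Complex.I * ξ * z) * ψ ξ

/-- The exponential sum over the translates of `ξ` by integers in `[-M, M)`. -/
noncomputable def fiberSum (M : ℕ) (ψ : ℝ → ℂ) (x ξ : ℝ) : ℂ :=
  ∑ i ∈ Finset.range (2 * M), Complex.exp (-Complex.I * (ξ + (i - M) : ℝ) * x) * ψ (ξ + (i - M))

theorem integral_eq_sum_shifts {E : Type*} [NormedAddCommGroup E] [NormedSpace ℝ E] {F : ℝ → E} (hF : Integrable F) {t : ℝ} {M : ℕ} (hM : t ≤ M)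
    (h0 : ∀ ξ, ξ ∉ Icc (-t) t → F ξ = 0) :
    ∫ ξ, F ξ = ∑ i ∈ Finset.range (2 * M), ∫ ξ in (0 : ℝ)..1, F (ξ + (i - M)) := by
  have h1 : ∫ ξ, F ξ = ∫ ξ in (-(M : ℝ))..M, F ξ := by
    rw [intervalIntegral.integral_of_le (by linarith [(Nat.cast_nonneg M : (0 : ℝ) ≤ M)]),
      ← integral_Icc_eq_integral_Ioc, setIntegral_eq_integral_of_forall_compl_eq_zero]
    intro ξ hξ
    apply h0
    contrapose! hξ
    exact ⟨by linarith [hξ.1], by linarith [hξ.2]⟩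
  have h2 := intervalIntegral.sum_integral_adjacent_intervals (f := F) (μ := volume)
    (a := fun i : ℕ => (i : ℝ) - M) (n := 2 * M) (fun k _ => hF.intervalIntegrable)
  rw [h1]
  simp only [intervalIntegral.integral_comp_add_right]
  convert h2.symm using 2
  · simp
  · simp only [Nat.cast_mul, Nat.cast_ofNat]
    ring
  · congr 1 <;> push_cast <;> ring

theorem MeasureTheory.MemLp.comp_add_restrict {F : ℝ → ℂ} (hF : MemLp F 2) (c : ℝ) (s : Set ℝ) :
    MemLp (fun ξ => F (ξ + c)) 2 (volume.restrict s) :=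
  (hF.comp_measurePreserving (measurePreserving_add_right volume c)).restrict s

theorem memLp_exp_mul {F : ℝ → ℂ} {μ : Measure ℝ} (hF : MemLp F 2 μ) {θ : ℝ → ℝ}
    (hθ : Continuous θ) : MemLp (fun ξ => Complex.exp (-Complex.I * θ ξ) * F ξ) 2 μ := by
  refine hF.of_le ?_ ?_
  · exact (Continuous.aestronglyMeasurable (by fun_prop)).mul hF.1
  · filter_upwards with ξ
    rw [norm_mul, show -Complex.I * (θ ξ : ℂ) = (-θ ξ : ℝ) * Complex.I by push_cast; ring,
      Complex.norm_exp_ofReal_mul_I, one_mul]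

theorem memLp_fiberSum {M : ℕ} {ψ : ℝ → ℂ} (hψ : MemLp ψ 2) (x : ℝ) (s : Set ℝ) :
    MemLp (fiberSum M ψ x) 2 (volume.restrict s) := by
  unfold fiberSum
  refine memLp_finsetSum _ fun i _ => ?_
  have := memLp_exp_mul (hψ.comp_add_restrict ((i : ℝ) - M) s)
    (θ := fun ξ => (ξ + (i - M)) * x) (by fun_prop)
  refine (memLp_congr_ae (ae_of_all _ fun ξ => ?_)).1 this
  simp only [Complex.ofReal_mul, mul_assoc]

/-- Parseval for pairs, by polarization of the norm identity for `f + c g` with `c = ±1, ±i`. -/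
theorem hasSum_fourierCoeffOn_mul_conj {f g : ℝ → ℂ}
    (hf : MemLp f 2 (volume.restrict (Ioc (0 : ℝ) 1)))
    (hg : MemLp g 2 (volume.restrict (Ioc (0 : ℝ) 1))) :
    HasSum (fun k : ℤ => fourierCoeffOn zero_lt_one f k * conj (fourierCoeffOn zero_lt_one g k))
      (∫ ξ in (0 : ℝ)..1, f ξ * conj (g ξ)) := by
  have hadd : ∀ (c : ℂ) (k : ℤ), fourierCoeffOn zero_lt_one (fun ξ => f ξ + c * g ξ) k =
      fourierCoeffOn zero_lt_one f k + c * fourierCoeffOn zero_lt_one g k := by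
    intro c k
    have hi : ∀ u : ℝ → ℂ, MemLp u 2 (volume.restrict (Ioc (0 : ℝ) 1)) →
        IntervalIntegrable (fun x => fourier (-k) (x : AddCircle ((1 : ℝ) - 0)) * u x) volume 0 1 := by
      intro u hu
      have : IntervalIntegrable u volume 0 1 :=
        (intervalIntegrable_iff_integrableOn_Ioc_of_le zero_le_one).2 (hu.integrable (by norm_num))
      refine this.continuousOn_mul (Continuous.continuousOn ?_)
      exact (map_continuous (fourier (-k))).comp (AddCircle.continuous_mk' _)
    simp only [fourierCoeffOn_eq_integral, smul_eq_mul, mul_add]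
    rw [intervalIntegral.integral_add (hi f hf), smul_add]
    · congr 1
      simp only [mul_left_comm _ c, intervalIntegral.integral_const_mul, mul_smul_comm]
    · exact hi _ (hg.const_mul c)
  have key : ∀ c : ℂ, HasSum (fun k : ℤ => (↑(‖fourierCoeffOn zero_lt_one f k +
      c * fourierCoeffOn zero_lt_one g k‖ ^ 2 : ℝ) : ℂ))
      (∫ ξ in (0 : ℝ)..1, ((‖f ξ + c * g ξ‖ ^ 2 : ℝ) : ℂ)) := by
    intro c
    have := hasSum_sq_fourierCoeffOn (zero_lt_one (α := ℝ)) (hf.add (hg.const_mul c))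
    have h2 := Complex.hasSum_ofReal.2 this
    simp only [Pi.add_apply, sub_zero, inv_one, one_smul] at h2
    rw [← intervalIntegral.integral_ofReal] at h2
    convert h2 using 4 with k
    exact congrArg _ (hadd c k).symm
  have pol : ∀ a b : ℂ, a * conj b = (1 / 4 : ℂ) * (((‖a + 1 * b‖ ^ 2 : ℝ) : ℂ) -
      ((‖a + (-1) * b‖ ^ 2 : ℝ) : ℂ) + Complex.I * ((‖a + Complex.I * b‖ ^ 2 : ℝ) : ℂ) -
      Complex.I * ((‖a + (-Complex.I) * b‖ ^ 2 : ℝ) : ℂ)) := by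
    intro a b
    simp only [← Complex.normSq_eq_norm_sq, ← Complex.mul_conj, map_add, map_mul, map_neg,
      Complex.conj_I, map_one]
    ring_nf
    simp only [Complex.I_sq]
    ring
  have hint : ∀ c : ℂ, IntervalIntegrable (fun ξ => ((‖f ξ + c * g ξ‖ ^ 2 : ℝ) : ℂ)) volume 0 1 := by
    intro c
    rw [intervalIntegrable_iff_integrableOn_Ioc_of_le zero_le_one]
    exact ((hf.add (hg.const_mul c)).integrable_norm_pow (by norm_num)).ofReal
  simp_rw [pol]
  rw [intervalIntegral.integral_const_mul, intervalIntegral.integral_sub,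
    intervalIntegral.integral_add, intervalIntegral.integral_sub (hint _) (hint _),
    intervalIntegral.integral_const_mul, intervalIntegral.integral_const_mul]
  · exact ((((key 1).sub (key (-1))).add ((key Complex.I).mul_left _)).sub
      ((key (-Complex.I)).mul_left _)).mul_left _
  · exact (hint _).sub (hint _)
  · exact (hint _).const_mul _
  · exact ((hint _).sub (hint _)).add ((hint _).const_mul _)
  · exact (hint _).const_mul _

/-- Moving `ξ` by an integer does not change `e^{-2πikξ}`, so the integral over `[-t, t]` folds onto
`[0, 1]` with this factor in common. -/
theorem pwTransform_add_period {t : ℝ} {M : ℕ} (hM : t ≤ M) {ψ : ℝ → ℂ}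
    (hψ : MemLp ψ 2 (volume.restrict (Icc (-t) t))) (x : ℝ) (k : ℤ) :
    pwTransform t ψ (x + 2 * Real.pi * k : ℝ) = ((Real.sqrt (2 * Real.pi) : ℝ) : ℂ)⁻¹ *
      fourierCoeffOn zero_lt_one (fiberSum M ((Icc (-t) t).indicator ψ) x) k := by
  set ψ0 := (Icc (-t) t).indicator ψ with hψ0
  have hm : MemLp ψ0 2 := (memLp_indicator_iff_restrict measurableSet_Icc).2 hψ
  have hi0 : Integrable ψ0 := by
    rw [hψ0, integrable_indicator_iff measurableSet_Icc]
    exact hψ.integrable (by norm_num)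
  unfold pwTransform
  congr 1
  have e1 : ∫ ξ in Icc (-t) t, Complex.exp (-Complex.I * ξ * (x + 2 * Real.pi * k : ℝ)) * ψ ξ =
      ∫ ξ : ℝ, Complex.exp (-Complex.I * ξ * (x + 2 * Real.pi * k : ℝ)) * ψ0 ξ := by
    rw [← integral_indicator measurableSet_Icc]
    congr 1; ext ξ
    by_cases h : ξ ∈ Icc (-t) t <;> simp [hψ0, h]
  have hexp : ∀ y : ℝ, ∀ ξ : ℝ, ‖Complex.exp (-Complex.I * ξ * y)‖ = 1 := by
    intro y ξ
    rw [show -Complex.I * (ξ : ℂ) * y = (-(ξ * y) : ℝ) * Complex.I by push_cast; ring,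
      Complex.norm_exp_ofReal_mul_I]
  have hI : ∀ y : ℝ, Integrable fun ξ : ℝ => Complex.exp (-Complex.I * ξ * y) * ψ0 ξ := by
    intro y
    refine hi0.bdd_mul (c := 1) (Continuous.aestronglyMeasurable (by fun_prop)) ?_
    filter_upwards with ξ
    rw [hexp]
  rw [e1, integral_eq_sum_shifts (hI _) hM (by intro ξ hξ; simp [hψ0, hξ]),
    fourierCoeffOn_eq_integral]
  simp only [sub_zero, div_one, one_smul, fiberSum, smul_eq_mul, Finset.mul_sum]
  rw [intervalIntegral.integral_finsetSum]
  · refine Finset.sum_congr rfl fun i _ => intervalIntegral.integral_congr fun ξ _ => ?_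
    simp only [fourier_coe_apply, ← mul_assoc, ← Complex.exp_add]
    congr 1
    -- The two exponents differ by `-2πik(i - M)`, an integer multiple of `2πi`.
    rw [Complex.exp_eq_exp_iff_exists_int]
    refine ⟨-(k * ((i : ℤ) - M)), ?_⟩
    push_cast
    ring
  · intro i _
    have h := (hI x).comp_add_right ((i : ℝ) - M)
    refine (h.intervalIntegrable (a := 0) (b := 1)).continuousOn_mul (Continuous.continuousOn ?_)
    exact (map_continuous (fourier (-k))).comp (AddCircle.continuous_mk' _)

theorem hasSum_pwTransform_mul_conj {t : ℝ} {M : ℕ} (hM : t ≤ M) {ψ χ : ℝ → ℂ}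
    (hψ : MemLp ψ 2 (volume.restrict (Icc (-t) t)))
    (hχ : MemLp χ 2 (volume.restrict (Icc (-t) t))) (x : ℝ) :
    HasSum (fun k : ℤ => pwTransform t ψ (x + 2 * Real.pi * k : ℝ) *
        conj (pwTransform t χ (x + 2 * Real.pi * k : ℝ)))
      ((2 * Real.pi : ℂ)⁻¹ * ∫ ξ in (0 : ℝ)..1, fiberSum M ((Icc (-t) t).indicator ψ) x ξ *
        conj (fiberSum M ((Icc (-t) t).indicator χ) x ξ)) := by
  have h1 := (memLp_indicator_iff_restrict measurableSet_Icc).2 hψ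
  have h2 := (memLp_indicator_iff_restrict measurableSet_Icc).2 hχ
  refine ((hasSum_fourierCoeffOn_mul_conj (memLp_fiberSum (M := M) h1 x _)
    (memLp_fiberSum (M := M) h2 x _)).mul_left ((2 * Real.pi : ℂ)⁻¹)).congr_fun fun k => ?_
  rw [pwTransform_add_period hM hψ, pwTransform_add_period hM hχ, map_mul, map_inv₀,
    Complex.conj_ofReal]
  have : (2 * Real.pi : ℂ)⁻¹ = ((Real.sqrt (2 * Real.pi) : ℝ) : ℂ)⁻¹ *
      ((Real.sqrt (2 * Real.pi) : ℝ) : ℂ)⁻¹ := by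
    rw [← mul_inv, ← Complex.ofReal_mul, Real.mul_self_sqrt (by positivity)]
    push_cast; rfl
  rw [this]; ring

/-- The variable `x` survives only in the factors `e^{-i(i-l)x}`; integrating these in `x` will
produce the moments. -/
theorem integral_fiberSum_mul_conj {M : ℕ} {ψ χ : ℝ → ℂ} (hψ : MemLp ψ 2) (hχ : MemLp χ 2)
    (x : ℝ) :
    ∫ ξ in (0 : ℝ)..1, fiberSum M ψ x ξ * conj (fiberSum M χ x ξ) =
      ∑ i ∈ Finset.range (2 * M), ∑ l ∈ Finset.range (2 * M),
        Complex.exp (-Complex.I * ((i : ℝ) - l : ℝ) * x) *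
          ∫ ξ in (0 : ℝ)..1, ψ (ξ + (i - M)) * conj (χ (ξ + (l - M))) := by
  have hI : ∀ i l : ℕ, IntervalIntegrable
      (fun ξ : ℝ => ψ (ξ + (i - M)) * conj (χ (ξ + (l - M)))) volume 0 1 := by
    intro i l
    rw [intervalIntegrable_iff_integrableOn_Ioc_of_le zero_le_one]
    exact (hψ.comp_add_restrict _ _).integrable_mul (hχ.comp_add_restrict _ _).star
  simp_rw [← intervalIntegral.integral_const_mul]
  simp_rw [← intervalIntegral.integral_finsetSum fun l (_ : l ∈ Finset.range (2 * M)) =>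
    (hI _ l).const_mul _]
  rw [← intervalIntegral.integral_finsetSum]
  · refine intervalIntegral.integral_congr fun ξ _ => ?_
    simp only [fiberSum, map_sum, Finset.sum_mul_sum]
    refine Finset.sum_congr rfl fun i _ => Finset.sum_congr rfl fun l _ => ?_
    rw [map_mul, ← Complex.exp_conj, mul_mul_mul_comm, ← Complex.exp_add]
    congr 2
    simp only [map_mul, map_neg, Complex.conj_I, Complex.conj_ofReal]
    push_cast; ring
  · intro i _
    have := IntervalIntegrable.sum (Finset.range (2 * M)) fun l _ => (hI i l).const_mul
      (Complex.exp (-Complex.I * ((i : ℝ) - l : ℝ) * x))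
    simpa only [Finset.sum_fn] using this

/-! ### Pairings against periodic measures as Toeplitz forms -/

/-- The superposition of all translates of `ρ` by multiples of `2π`. -/
noncomputable def periodization (ρ : Measure ℝ) : Measure ℝ :=
  Measure.sum fun k : ℤ => ρ.map fun x => x + 2 * Real.pi * k

/-- The moments `(2π)⁻¹ ∫ e^{-i(j-l)x} dρ(x)`, arranged as a Toeplitz matrix. -/
noncomputable def toeplitzMoment (ρ : Measure ℝ) (j l : ℕ) : ℂ :=
  (2 * Real.pi : ℂ)⁻¹ * ∫ x, Complex.exp (-Complex.I * ((j : ℝ) - l : ℝ) * x) ∂ρ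

theorem lintegral_periodization (ρ : Measure ℝ) {F : ℝ → ENNReal} (hF : Measurable F) :
    ∫⁻ x, F x ∂(periodization ρ) = ∫⁻ x, ∑' k : ℤ, F (x + 2 * Real.pi * k) ∂ρ := by
  rw [periodization, lintegral_sum_measure, lintegral_tsum]
  · congr 1; ext k
    rw [lintegral_map hF (by fun_prop)]
  · intro k
    exact (hF.comp (by fun_prop)).aemeasurable

theorem integral_periodization (ρ : Measure ℝ) {F : ℝ → ℂ} (hF : Continuous F)
    (hi : Integrable F (periodization ρ)) :
    ∫ x, F x ∂(periodization ρ) = ∫ x, ∑' k : ℤ, F (x + 2 * Real.pi * k) ∂ρ := by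
  have h := hi.2
  rw [hasFiniteIntegral_iff_enorm, lintegral_periodization _ (by fun_prop), lintegral_tsum] at h
  · rw [integral_tsum _ h.ne, periodization, integral_sum_measure hi]
    · congr 1; ext k
      rw [integral_map (by fun_prop) hF.aestronglyMeasurable]
    · intro k
      exact Continuous.aestronglyMeasurable (by fun_prop)
  · intro k
    exact (Continuous.measurable (by fun_prop)).aemeasurable

theorem continuous_pwTransform {t : ℝ} {ψ : ℝ → ℂ}
    (hψ : MemLp ψ 2 (volume.restrict (Icc (-t) t))) :
    Continuous fun x : ℝ => pwTransform t ψ x := by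
  have hi := hψ.integrable (q := 2) (by norm_num)
  unfold pwTransform
  refine continuous_const.mul (continuous_of_dominated (bound := fun ξ => ‖ψ ξ‖) ?_ ?_ hi.norm ?_)
  · intro x
    exact (Continuous.aestronglyMeasurable (by fun_prop)).mul hi.1
  · intro x
    filter_upwards with ξ
    rw [norm_mul, show -Complex.I * (ξ : ℂ) * x = (-(ξ * x) : ℝ) * Complex.I by push_cast; ring,
      Complex.norm_exp_ofReal_mul_I, one_mul]
  · filter_upwards with ξ
    fun_prop

/-- Cauchy–Schwarz over the `2M` translates. The bound does not depend on `x`, so it can be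
integrated against any finite measure. -/
theorem norm_integral_fiberSum_le {t : ℝ} {M : ℕ} (hM : t ≤ M) {ψ : ℝ → ℂ}
    (hψ : MemLp ψ 2 (volume.restrict (Icc (-t) t))) (x : ℝ) :
    ‖(2 * Real.pi : ℂ)⁻¹ * ∫ ξ in (0 : ℝ)..1, fiberSum M ((Icc (-t) t).indicator ψ) x ξ *
        conj (fiberSum M ((Icc (-t) t).indicator ψ) x ξ)‖ ≤
      (2 * Real.pi)⁻¹ * (2 * M * ∫ ξ in Icc (-t) t, ‖ψ ξ‖ ^ 2) := by
  have hm := (memLp_indicator_iff_restrict measurableSet_Icc).2 hψ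
  have hsq : Integrable fun ξ => ‖(Icc (-t) t).indicator ψ ξ‖ ^ 2 :=
    hm.integrable_norm_pow (by norm_num)
  rw [norm_mul]
  have h2 : ‖(2 * Real.pi : ℂ)⁻¹‖ = (2 * Real.pi)⁻¹ := by
    rw [norm_inv, ← Complex.ofReal_ofNat, ← Complex.ofReal_mul, Complex.norm_real,
      Real.norm_of_nonneg (by positivity)]
  rw [h2]
  refine mul_le_mul_of_nonneg_left ?_ (by positivity)
  have e1 : ∫ ξ in Icc (-t) t, ‖ψ ξ‖ ^ 2 = ∫ ξ, ‖(Icc (-t) t).indicator ψ ξ‖ ^ 2 := by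
    rw [← integral_indicator measurableSet_Icc]
    congr 1; ext ξ
    by_cases h : ξ ∈ Icc (-t) t <;> simp [h]
  rw [e1, integral_eq_sum_shifts hsq hM (by intro ξ hξ; simp [hξ]), Finset.mul_sum]
  simp_rw [← intervalIntegral.integral_const_mul]
  have hI : ∀ i : ℕ, IntervalIntegrable
      (fun ξ => 2 * (M : ℝ) * ‖(Icc (-t) t).indicator ψ (ξ + (i - M))‖ ^ 2) volume 0 1 := by
    intro i
    exact ((hsq.comp_add_right _).intervalIntegrable).const_mul _
  rw [← intervalIntegral.integral_finsetSum fun i _ => hI i]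
  refine (intervalIntegral.norm_integral_le_integral_norm zero_le_one).trans ?_
  refine intervalIntegral.integral_mono_on zero_le_one ?_ ?_ ?_
  · rw [intervalIntegrable_iff_integrableOn_Ioc_of_le zero_le_one]
    exact ((memLp_fiberSum hm x _).integrable_mul (memLp_fiberSum hm x _).star).norm
  · have := IntervalIntegrable.sum (Finset.range (2 * M)) fun i _ => hI i
    simpa only [Finset.sum_fn] using this
  · intro ξ _
    rw [norm_mul, RCLike.norm_conj, ← sq, ← Finset.mul_sum]
    have h3 : ‖fiberSum M ((Icc (-t) t).indicator ψ) x ξ‖ ≤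
        ∑ i ∈ Finset.range (2 * M), ‖(Icc (-t) t).indicator ψ (ξ + (i - M))‖ := by
      refine norm_sum_le_of_le _ fun i _ => ?_
      rw [norm_mul, show -Complex.I * ((ξ + (i - M) : ℝ) : ℂ) * x =
        (-((ξ + (i - M)) * x) : ℝ) * Complex.I by push_cast; ring,
        Complex.norm_exp_ofReal_mul_I, one_mul]
    refine (pow_le_pow_left₀ (norm_nonneg _) h3 2).trans ?_
    refine (sq_sum_le_card_mul_sum_sq (s := Finset.range (2 * M))).trans_eq ?_
    simp

theorem memLp_pwTransform (ρ : Measure ℝ) [IsFiniteMeasure ρ] {t : ℝ} {ψ : ℝ → ℂ}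
    (hψ : MemLp ψ 2 (volume.restrict (Icc (-t) t))) :
    MemLp (fun x : ℝ => pwTransform t ψ x) 2 (periodization ρ) := by
  have hc := continuous_pwTransform hψ
  obtain ⟨M, hM⟩ := exists_nat_ge t
  rw [memLp_two_iff_integrable_sq_norm hc.aestronglyMeasurable]
  refine ⟨(hc.norm.pow 2).aestronglyMeasurable, ?_⟩
  rw [hasFiniteIntegral_iff_enorm, lintegral_periodization _
    (F := fun x => ‖‖pwTransform t ψ x‖ ^ 2‖ₑ) (hc.norm.pow 2).measurable.enorm]
  refine lt_of_le_of_lt (lintegral_mono (g := fun _ => ENNReal.ofReal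
    ((2 * Real.pi)⁻¹ * (2 * M * ∫ ξ in Icc (-t) t, ‖ψ ξ‖ ^ 2))) fun x => ?_) ?_
  · have h := Complex.hasSum_re (hasSum_pwTransform_mul_conj hM hψ hψ x)
    simp only [Complex.mul_conj, Complex.ofReal_re, Complex.normSq_eq_norm_sq] at h
    simp_rw [Real.enorm_eq_ofReal (sq_nonneg _)]
    rw [← ENNReal.ofReal_tsum_of_nonneg (fun _ => sq_nonneg _) h.summable, h.tsum_eq]
    refine ENNReal.ofReal_le_ofReal ((Complex.re_le_norm _).trans ?_)
    have := norm_integral_fiberSum_le hM hψ x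
    simpa only [Complex.mul_conj, Complex.normSq_eq_norm_sq] using this
  · rw [lintegral_const]
    exact ENNReal.mul_lt_top ENNReal.ofReal_lt_top (measure_lt_top _ _)

theorem linePairing_periodization (ρ : Measure ℝ) [IsFiniteMeasure ρ] {t : ℝ} {M : ℕ} (hM : t ≤ M)
    {ψ χ : ℝ → ℂ} (hψ : MemLp ψ 2 (volume.restrict (Icc (-t) t)))
    (hχ : MemLp χ 2 (volume.restrict (Icc (-t) t))) :
    linePairing (periodization ρ) (pwTransform t ψ) (pwTransform t χ) =
      ∫ x, ((2 * Real.pi : ℂ)⁻¹ * ∫ ξ in (0 : ℝ)..1, fiberSum M ((Icc (-t) t).indicator ψ) x ξ *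
        conj (fiberSum M ((Icc (-t) t).indicator χ) x ξ)) ∂ρ := by
  have h1 := continuous_pwTransform hψ
  have h2 := continuous_pwTransform hχ
  unfold linePairing
  rw [integral_periodization ρ (F := fun x => pwTransform t ψ x * conj (pwTransform t χ x))
    (h1.mul (Complex.continuous_conj.comp h2))
    ((memLp_pwTransform ρ hψ).integrable_mul (memLp_pwTransform ρ hχ).star)]
  congr 1; ext x
  exact (hasSum_pwTransform_mul_conj hM hψ hχ x).tsum_eq

/-- The central formula. The sums over `k` have been evaluated by Parseval, and what remains is to
integrate the exponentials in `x`. -/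
theorem linePairing_periodization_eq_sum (ρ : Measure ℝ) [IsFiniteMeasure ρ] {t : ℝ} {M : ℕ}
    (hM : t ≤ M) {ψ χ : ℝ → ℂ} (hψ : MemLp ψ 2 (volume.restrict (Icc (-t) t)))
    (hχ : MemLp χ 2 (volume.restrict (Icc (-t) t))) :
    linePairing (periodization ρ) (pwTransform t ψ) (pwTransform t χ) =
      ∫ ξ in (0 : ℝ)..1, ∑ i ∈ Finset.range (2 * M), ∑ l ∈ Finset.range (2 * M),
        toeplitzMoment ρ i l * ((Icc (-t) t).indicator ψ (ξ + (i - M)) *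
          conj ((Icc (-t) t).indicator χ (ξ + (l - M)))) := by
  have m1 := (memLp_indicator_iff_restrict measurableSet_Icc).2 hψ
  have m2 := (memLp_indicator_iff_restrict measurableSet_Icc).2 hχ
  rw [linePairing_periodization ρ hM hψ hχ]
  simp_rw [integral_fiberSum_mul_conj m1 m2]
  have hI : ∀ i l : ℕ, IntervalIntegrable (fun ξ : ℝ => (Icc (-t) t).indicator ψ (ξ + (i - M)) *
      conj ((Icc (-t) t).indicator χ (ξ + (l - M)))) volume 0 1 := by
    intro i l
    rw [intervalIntegrable_iff_integrableOn_Ioc_of_le zero_le_one]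
    exact (m1.comp_add_restrict _ _).integrable_mul (m2.comp_add_restrict _ _).star
  have hE : ∀ i l : ℕ, Integrable
      (fun x : ℝ => Complex.exp (-Complex.I * ((i : ℝ) - l : ℝ) * x)) ρ := by
    intro i l
    refine Integrable.of_bound (Continuous.aestronglyMeasurable (by fun_prop)) 1 ?_
    filter_upwards with x
    rw [show -Complex.I * ((i - l : ℝ) : ℂ) * x = (-((i - l) * x) : ℝ) * Complex.I by
      push_cast; ring, Complex.norm_exp_ofReal_mul_I]
  rw [integral_const_mul, integral_finsetSum _ fun i _ =>
    integrable_finsetSum _ fun l _ => (hE i l).mul_const _, intervalIntegral.integral_finsetSum,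
    Finset.mul_sum]
  · refine Finset.sum_congr rfl fun i _ => ?_
    rw [integral_finsetSum _ fun l _ => (hE i l).mul_const _,
      intervalIntegral.integral_finsetSum fun l _ => (hI i l).const_mul _, Finset.mul_sum]
    refine Finset.sum_congr rfl fun l _ => ?_
    rw [integral_mul_const, intervalIntegral.integral_const_mul, toeplitzMoment, mul_assoc]
  · intro i _
    have := IntervalIntegrable.sum (Finset.range (2 * M)) fun l _ => (hI i l).const_mul
      (toeplitzMoment ρ i l)
    simpa only [Finset.sum_fn] using this

theorem integral_norm_sq_eq_linePairing (ν : Measure ℝ) (f : ℂ → ℂ) :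
    ((∫ x : ℝ, ‖f x‖ ^ 2 ∂ν : ℝ) : ℂ) = linePairing ν f f := by
  simp only [linePairing, Complex.mul_conj, Complex.normSq_eq_norm_sq]
  rw [integral_complex_ofReal]

theorem integral_norm_sq_pwTransform_le (ρ : Measure ℝ) [IsFiniteMeasure ρ] {t : ℝ} {M : ℕ}
    (hM : t ≤ M) {ψ : ℝ → ℂ} (hψ : MemLp ψ 2 (volume.restrict (Icc (-t) t))) :
    ∫ x : ℝ, ‖pwTransform t ψ x‖ ^ 2 ∂(periodization ρ) ≤
      ((2 * Real.pi)⁻¹ * (2 * M) * ρ.real univ) * ∫ ξ in Icc (-t) t, ‖ψ ξ‖ ^ 2 := by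
  have h := integral_norm_sq_eq_linePairing (periodization ρ) (pwTransform t ψ)
  rw [linePairing_periodization ρ hM hψ hψ] at h
  have h2 := norm_integral_le_of_norm_le_const (μ := ρ)
    (ae_of_all _ (norm_integral_fiberSum_le hM hψ))
  rw [← h, Complex.norm_real] at h2
  refine (le_abs_self _).trans (h2.trans_eq ?_)
  ring

/-- Lebesgue measure is itself a periodization, so every formula for periodic measures also applies
to the scalar product of `L²(ℝ)`. -/
theorem periodization_restrict_Ioc :
    periodization (volume.restrict (Ioc (-Real.pi) Real.pi)) = volume := by
  have h1 : ∀ k : ℤ, (volume.restrict (Ioc (-Real.pi) Real.pi)).map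
      (fun x => x + 2 * Real.pi * k) =
      volume.restrict (Ioc (-Real.pi + k • (2 * Real.pi)) (-Real.pi + (k + 1) • (2 * Real.pi))) := by
    intro k
    have h := (measurePreserving_add_right volume (2 * Real.pi * k)).restrict_preimage
      (measurableSet_Ioc (a := -Real.pi + k • (2 * Real.pi))
        (b := -Real.pi + (k + 1) • (2 * Real.pi)))
    rw [← h.map_eq]
    congr 2
    ext x
    simp only [mem_Ioc, mem_preimage, zsmul_eq_mul]
    push_cast
    constructor <;> rintro ⟨a, b⟩ <;> constructor <;> linarith
  rw [periodization]
  simp_rw [h1]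
  rw [← Measure.restrict_iUnion (pairwise_disjoint_Ioc_add_zsmul _ _) fun _ => measurableSet_Ioc,
    iUnion_Ioc_add_zsmul Real.two_pi_pos, Measure.restrict_univ]

theorem toeplitzMoment_restrict_Ioc (j l : ℕ) :
    toeplitzMoment (volume.restrict (Ioc (-Real.pi) Real.pi)) j l = if j = l then 1 else 0 := by
  have hpi : (Real.pi : ℂ) ≠ 0 := Complex.ofReal_ne_zero.2 Real.pi_ne_zero
  rw [toeplitzMoment, ← intervalIntegral.integral_of_le (by linarith [Real.pi_pos])]
  split_ifs with h
  · subst h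
    simp
    field_simp
    norm_num
  · have hne : ((j : ℝ) - l : ℝ) ≠ 0 := sub_ne_zero.2 (by exact_mod_cast h)
    rw [integral_exp_mul_complex (mul_ne_zero (neg_ne_zero.2 Complex.I_ne_zero)
      (Complex.ofReal_ne_zero.2 hne))]
    have : Complex.exp (-Complex.I * ((j : ℝ) - l : ℝ) * (Real.pi : ℝ)) =
        Complex.exp (-Complex.I * ((j : ℝ) - l : ℝ) * (-Real.pi : ℝ)) := by
      rw [Complex.exp_eq_exp_iff_exists_int]
      refine ⟨-(j - l), ?_⟩
      push_cast; ring
    rw [this]; simp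

/-- Plancherel, as the case of the Toeplitz formula in which the matrix is the identity. -/
theorem linePairing_volume {t : ℝ} {ψ χ : ℝ → ℂ}
    (hψ : MemLp ψ 2 (volume.restrict (Icc (-t) t)))
    (hχ : MemLp χ 2 (volume.restrict (Icc (-t) t))) :
    linePairing volume (pwTransform t ψ) (pwTransform t χ) =
      ∫ ξ in Icc (-t) t, ψ ξ * conj (χ ξ) := by
  obtain ⟨M, hM⟩ := exists_nat_ge t
  have m1 := (memLp_indicator_iff_restrict measurableSet_Icc).2 hψ
  have m2 := (memLp_indicator_iff_restrict measurableSet_Icc).2 hχ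
  have hI : Integrable fun ξ => (Icc (-t) t).indicator ψ ξ * conj ((Icc (-t) t).indicator χ ξ) :=
    m1.integrable_mul m2.star
  have e1 : ∫ ξ in Icc (-t) t, ψ ξ * conj (χ ξ) =
      ∫ ξ, (Icc (-t) t).indicator ψ ξ * conj ((Icc (-t) t).indicator χ ξ) := by
    rw [← integral_indicator measurableSet_Icc]
    congr 1; ext ξ
    by_cases h : ξ ∈ Icc (-t) t <;> simp [h]
  rw [← periodization_restrict_Ioc, linePairing_periodization_eq_sum _ hM hψ hχ,
    periodization_restrict_Ioc, e1,
    integral_eq_sum_shifts hI hM (by intro ξ hξ; simp [hξ]), ← intervalIntegral.integral_finsetSum]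
  · refine intervalIntegral.integral_congr fun ξ _ => ?_
    simp only [toeplitzMoment_restrict_Ioc]
    refine Finset.sum_congr rfl fun i hi => ?_
    simp only [ite_mul, one_mul, zero_mul, Finset.sum_ite_eq, hi, if_true]
  · intro i _
    exact (hI.comp_add_right _).intervalIntegrable

/-! ### Orthonormal polynomials and Toeplitz matrices -/

/-- The `m`-th coefficient (conjugated) of the reproducing kernel `∑_{k < N} conj (φ_k 1) φ_k`. -/
noncomputable def cdCoeff (φ : ℕ → Polynomial ℂ) (N m : ℕ) : ℂ :=
  ∑ k ∈ Finset.range N, (φ k).eval 1 * conj ((φ k).coeff m)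

theorem exists_eq_sum_of_degree_lt {φ : ℕ → Polynomial ℂ} (hφ : ∀ n, (φ n).degree = n) (N : ℕ) :
    ∀ p : Polynomial ℂ, p.degree < N →
      ∃ c : ℕ → ℂ, p = ∑ k ∈ Finset.range N, Polynomial.C (c k) * φ k := by
  induction N with
  | zero =>
    intro p hp
    refine ⟨0, ?_⟩
    simpa [Polynomial.degree_lt_iff_coeff_zero, Polynomial.ext_iff] using hp
  | succ N ih =>
    intro p hp
    have hN : (φ N).coeff N ≠ 0 := by
      have := Polynomial.coeff_ne_zero_of_eq_degree (hφ N)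
      exact this
    -- Cancel the coefficient of degree `N` with a multiple of `φ N`.
    obtain ⟨c, hc⟩ := ih (p - Polynomial.C (p.coeff N / (φ N).coeff N) * φ N) (by
      rw [Polynomial.degree_lt_iff_coeff_zero] at hp ⊢
      intro m hm
      rw [Polynomial.coeff_sub, Polynomial.coeff_C_mul]
      rcases hm.eq_or_lt with rfl | h
      · rw [div_mul_cancel₀ _ hN, sub_self]
      · rw [hp m h, Polynomial.coeff_eq_zero_of_degree_lt (p := φ N) (n := m), mul_zero, sub_zero]
        rw [hφ]; exact_mod_cast h)
    refine ⟨fun k => if k = N then p.coeff N / (φ N).coeff N else c k, ?_⟩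
    rw [Finset.sum_range_succ]
    simp only [if_true]
    rw [← sub_eq_iff_eq_add, hc]
    refine Finset.sum_congr rfl fun k hk => ?_
    rw [if_neg (Finset.mem_range.1 hk).ne]

theorem Circle.continuous_coe : Continuous fun z : Circle => (z : ℂ) := by fun_prop

theorem integrable_eval_mul_conj (μ : Measure Circle) [IsFiniteMeasure μ] (p q : Polynomial ℂ) :
    Integrable (fun z : Circle => p.eval (z : ℂ) * conj (q.eval (z : ℂ))) μ := by
  have hc : Continuous fun z : Circle => p.eval (z : ℂ) * conj (q.eval (z : ℂ)) :=
    (p.continuous.comp Circle.continuous_coe).mul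
      (Complex.continuous_conj.comp (q.continuous.comp Circle.continuous_coe))
  obtain ⟨C, hC⟩ := isCompact_univ.exists_bound_of_continuousOn hc.continuousOn
  exact Integrable.of_bound hc.aestronglyMeasurable C (ae_of_all _ fun z => hC z (mem_univ z))

namespace IsOrthonormalPolynomials

theorem integral_sum_mul_conj_sum {μ : Measure Circle} [IsFiniteMeasure μ]
    {φ : ℕ → Polynomial ℂ} (hφ : IsOrthonormalPolynomials μ φ) (N : ℕ) (c d : ℕ → ℂ) :
    (2 * Real.pi : ℂ)⁻¹ * ∫ z : Circle,
      (∑ k ∈ Finset.range N, Polynomial.C (c k) * φ k).eval (z : ℂ) *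
        conj ((∑ k ∈ Finset.range N, Polynomial.C (d k) * φ k).eval (z : ℂ)) ∂μ =
      ∑ k ∈ Finset.range N, c k * conj (d k) := by
  simp only [Polynomial.eval_finsetSum, Polynomial.eval_mul, Polynomial.eval_C, map_sum, map_mul,
    Finset.sum_mul_sum]
  have e : ∀ (i j : ℕ) (z : Circle), c i * (φ i).eval (z : ℂ) *
      (conj (d j) * conj ((φ j).eval (z : ℂ))) =
      c i * conj (d j) * ((φ i).eval (z : ℂ) * conj ((φ j).eval (z : ℂ))) := by
    intros; ring
  simp only [e]
  rw [integral_finsetSum _ fun i _ => integrable_finsetSum _ fun l _ =>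
    (integrable_eval_mul_conj μ _ _).const_mul _, Finset.mul_sum]
  refine Finset.sum_congr rfl fun i hi => ?_
  rw [integral_finsetSum _ fun l _ => (integrable_eval_mul_conj μ _ _).const_mul _, Finset.mul_sum]
  simp_rw [integral_const_mul, mul_left_comm _ (c i * _), hφ.2]
  simp only [mul_ite, mul_one, mul_zero, Finset.sum_ite_eq, hi, if_true]

/-- The coefficients of `φ_k` add up to `φ_k(1)`. -/
theorem sum_cdCoeff {μ : Measure Circle} {φ : ℕ → Polynomial ℂ}
    (hφ : IsOrthonormalPolynomials μ φ) (N : ℕ) :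
    ∑ m ∈ Finset.range N, cdCoeff φ N m =
      ((∑ k ∈ Finset.range N, ‖(φ k).eval 1‖ ^ 2 : ℝ) : ℂ) := by
  simp only [cdCoeff]
  rw [Finset.sum_comm]
  push_cast
  refine Finset.sum_congr rfl fun k hk => ?_
  have hd : (φ k).natDegree < N := by
    rw [Polynomial.natDegree_eq_of_degree_eq_some (hφ.1 k)]; exact Finset.mem_range.1 hk
  rw [← Finset.mul_sum, ← map_sum]
  have := Polynomial.eval_eq_sum_range' hd 1
  simp only [one_pow, mul_one] at this
  rw [← this, Complex.mul_conj, Complex.normSq_eq_norm_sq]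
  push_cast; rfl

end IsOrthonormalPolynomials

theorem toeplitzMoment_map_arg (μ : Measure Circle) (j l : ℕ) :
    toeplitzMoment (μ.map fun z : Circle => Complex.arg (z : ℂ)) j l =
      (2 * Real.pi : ℂ)⁻¹ * ∫ z : Circle, (z : ℂ) ^ l * conj ((z : ℂ) ^ j) ∂μ := by
  rw [toeplitzMoment, integral_map]
  · congr 2; ext z
    have hz : (z : ℂ) = Complex.exp (Complex.arg (z : ℂ) * Complex.I) := by
      conv_lhs => rw [← Complex.norm_mul_exp_arg_mul_I (z : ℂ), Circle.norm_coe]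
      rw [Complex.ofReal_one, one_mul]
    have e1 : (z : ℂ) ^ l = Complex.exp (l * (Complex.arg (z : ℂ) * Complex.I)) := by
      rw [Complex.exp_nat_mul, ← hz]
    have e2 : conj ((z : ℂ) ^ j) = Complex.exp (j * -(Complex.arg (z : ℂ) * Complex.I)) := by
      rw [Complex.exp_nat_mul, map_pow]
      conv_lhs => rw [hz, ← Complex.exp_conj]
      simp
    rw [e1, e2, ← Complex.exp_add]
    congr 1; push_cast; ring
  · exact (Complex.measurable_arg.comp Circle.continuous_coe.measurable).aemeasurable
  · exact Continuous.aestronglyMeasurable (by fun_prop)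

namespace IsOrthonormalPolynomials

variable {μ : Measure Circle} [IsFiniteMeasure μ] {φ : ℕ → Polynomial ℂ}

/-- The moment with indices `i, l` is the scalar product of `z^l` and `z^i`; this reversed order is
why the polynomials carry conjugated coefficients and swap places. -/
theorem sum_toeplitzMoment_eq_integral (a b : ℕ → ℂ) (N : ℕ) :
    ∑ i ∈ Finset.range N, ∑ l ∈ Finset.range N,
      toeplitzMoment (μ.map fun z : Circle => Complex.arg (z : ℂ)) i l * (a i * conj (b l)) =
    (2 * Real.pi : ℂ)⁻¹ * ∫ z : Circle,
      (∑ l ∈ Finset.range N, Polynomial.C (conj (b l)) * Polynomial.X ^ l).eval (z : ℂ) *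
        conj ((∑ l ∈ Finset.range N, Polynomial.C (conj (a l)) * Polynomial.X ^ l).eval (z : ℂ))
        ∂μ := by
  have hI : ∀ i l : ℕ, Integrable
      (fun z : Circle => (z : ℂ) ^ l * conj ((z : ℂ) ^ i)) μ := by
    intro i l
    simpa using integrable_eval_mul_conj μ (Polynomial.X ^ l) (Polynomial.X ^ i)
  simp only [Polynomial.eval_finsetSum, Polynomial.eval_mul, Polynomial.eval_C,
    Polynomial.eval_pow, Polynomial.eval_X, map_sum, map_mul,
    Finset.sum_mul_sum, mul_mul_mul_comm, Complex.conj_conj]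
  rw [integral_finsetSum _ fun i _ => integrable_finsetSum _ fun l _ => (hI _ _).const_mul _,
    Finset.mul_sum, Finset.sum_comm]
  refine Finset.sum_congr rfl fun i _ => ?_
  rw [integral_finsetSum _ fun l _ => (hI _ _).const_mul _, Finset.mul_sum]
  refine Finset.sum_congr rfl fun l _ => ?_
  rw [integral_const_mul, toeplitzMoment_map_arg]
  ring

/-- The kernel `∑_{k<N} conj(φ_k(1)) φ_k` reproduces values at `1` of polynomials of degree less
than `N`, and `z^m` has the value `1` there. -/
theorem sum_toeplitzMoment_mul_cdCoeff (hφ : IsOrthonormalPolynomials μ φ) {N m : ℕ} (hm : m < N) :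
    ∑ l ∈ Finset.range N, toeplitzMoment (μ.map fun z : Circle => Complex.arg (z : ℂ)) l m *
      cdCoeff φ N l = 1 := by
  have h := sum_toeplitzMoment_eq_integral (μ := μ) (cdCoeff φ N) (fun l => if l = m then 1 else 0) N
  have e1 : ∑ l ∈ Finset.range N, Polynomial.C (conj (if l = m then (1 : ℂ) else 0)) *
      Polynomial.X ^ l = Polynomial.X ^ m := by
    rw [Finset.sum_eq_single m]
    · simp
    · intro l _ hl; simp [hl]
    · intro h; exact absurd (Finset.mem_range.2 hm) h
  have e2 : ∑ l ∈ Finset.range N, Polynomial.C (conj (cdCoeff φ N l)) * Polynomial.X ^ l =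
      ∑ k ∈ Finset.range N, Polynomial.C (conj ((φ k).eval 1)) * φ k := by
    simp only [cdCoeff, map_sum, map_mul, Complex.conj_conj, Finset.sum_mul]
    rw [Finset.sum_comm]
    refine Finset.sum_congr rfl fun k hk => ?_
    have hd : (φ k).natDegree < N := by
      rw [Polynomial.natDegree_eq_of_degree_eq_some (hφ.1 k)]; exact Finset.mem_range.1 hk
    conv_rhs => arg 2; rw [(φ k).as_sum_range' N hd]
    rw [Finset.mul_sum]
    simp only [mul_assoc, Polynomial.C_mul_X_pow_eq_monomial]
  obtain ⟨c, hc⟩ := exists_eq_sum_of_degree_lt hφ.1 N (Polynomial.X ^ m) (by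
    rw [Polynomial.degree_X_pow]; exact_mod_cast hm)
  rw [e1, e2, hc, hφ.integral_sum_mul_conj_sum] at h
  have hev := congrArg (Polynomial.eval 1) hc
  simp only [Polynomial.eval_pow, Polynomial.eval_X, one_pow, Polynomial.eval_finsetSum,
    Polynomial.eval_mul, Polynomial.eval_C] at hev
  simp only [Complex.conj_conj, ← hev] at h
  rw [← h]
  refine Finset.sum_congr rfl fun i _ => ?_
  rw [Finset.sum_eq_single m]
  · simp
  · intro l _ hl; simp [hl]
  · intro h; exact absurd (Finset.mem_range.2 hm) h

/-- In the basis `φ_k` the form is `∑ |c_k|²`, and Cauchy–Schwarz bounds the monomial coefficients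
by the `c_k`. -/
theorem exists_coercive (hφ : IsOrthonormalPolynomials μ φ) (N : ℕ) :
    ∃ c : ℝ, 0 < c ∧ ∀ a : ℕ → ℂ, c * ∑ i ∈ Finset.range N, ‖a i‖ ^ 2 ≤
      (∑ i ∈ Finset.range N, ∑ l ∈ Finset.range N,
        toeplitzMoment (μ.map fun z : Circle => Complex.arg (z : ℂ)) i l *
          (a i * conj (a l))).re := by
  -- The summand `1` keeps `K` positive even for `N = 0`.
  set K : ℝ := 1 + ∑ i ∈ Finset.range N, ∑ k ∈ Finset.range N, ‖(φ k).coeff i‖ ^ 2 with hK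
  have hKpos : 0 < K := by positivity
  refine ⟨K⁻¹, inv_pos.2 hKpos, fun a => ?_⟩
  rw [sum_toeplitzMoment_eq_integral]
  set p : Polynomial ℂ := ∑ l ∈ Finset.range N, Polynomial.C (conj (a l)) * Polynomial.X ^ l with hp
  have hcoeff : ∀ i ∈ Finset.range N, p.coeff i = conj (a i) := by
    intro i hi
    rw [hp, Polynomial.finsetSum_coeff]
    simp only [Polynomial.coeff_C_mul_X_pow, Finset.sum_ite_eq, hi, if_true]
  obtain ⟨c, hc⟩ := exists_eq_sum_of_degree_lt hφ.1 N p (by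
    rw [hp, Polynomial.degree_lt_iff_coeff_zero]
    intro m hm
    rw [Polynomial.finsetSum_coeff]
    refine Finset.sum_eq_zero fun l hl => ?_
    rw [Polynomial.coeff_C_mul_X_pow, if_neg]
    have := Finset.mem_range.1 hl
    omega)
  have hre : (∑ k ∈ Finset.range N, c k * conj (c k)).re = ∑ k ∈ Finset.range N, ‖c k‖ ^ 2 := by
    simp only [Complex.mul_conj, Complex.normSq_eq_norm_sq, Complex.re_sum, Complex.ofReal_re]
  rw [hc, hφ.integral_sum_mul_conj_sum, hre, inv_mul_le_iff₀ hKpos]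
  have hb : ∀ i ∈ Finset.range N, ‖a i‖ ^ 2 ≤
      (∑ k ∈ Finset.range N, ‖(φ k).coeff i‖ ^ 2) * ∑ k ∈ Finset.range N, ‖c k‖ ^ 2 := by
    intro i hi
    rw [← RCLike.norm_conj (a i), ← hcoeff i hi, hc, Polynomial.finsetSum_coeff]
    simp only [Polynomial.coeff_C_mul]
    refine (pow_le_pow_left₀ (norm_nonneg _) (norm_sum_le _ _) 2).trans ?_
    simp only [norm_mul]
    rw [mul_comm]
    exact Finset.sum_mul_sq_le_sq_mul_sq _ _ _
  refine (Finset.sum_le_sum hb).trans ?_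
  rw [← Finset.sum_mul]
  refine mul_le_mul_of_nonneg_right ?_ (by positivity)
  rw [hK]; linarith

end IsOrthonormalPolynomials

/-! ### The Fourier data of `k_t` and its integral -/

/-- The Fourier data of `k_t`: at `ξ` it is the solution of the Toeplitz system over the integer
translates of `ξ` in `[-t, t]`. -/
noncomputable def kernelDensity (φ : ℕ → Polynomial ℂ) (t ξ : ℝ) : ℂ :=
  ((Real.sqrt (2 * Real.pi) : ℝ) : ℂ)⁻¹ *
    -- For `ξ` in `[-t, t]`, the first argument is the number of points of `ξ + ℤ` in `[-t, t]`, the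
    -- second the number of those to the left of `ξ`.
    cdCoeff φ (⌊ξ + t⌋ + ⌊t - ξ⌋ + 1).toNat ⌊ξ + t⌋.toNat

/-- The density depends only on two floors, which take finitely many values on `[-t, t]`; hence it
is bounded. -/
theorem memLp_kernelDensity (φ : ℕ → Polynomial ℂ) (t : ℝ) :
    MemLp (kernelDensity φ t) 2 (volume.restrict (Icc (-t) t)) := by
  refine MemLp.const_mul ?_ _
  have key : ∀ f : ℤ × ℤ → ℂ, Measurable fun ξ : ℝ => f (⌊ξ + t⌋, ⌊t - ξ⌋) := fun f =>
    (measurable_of_countable f).comp (Measurable.prodMk (by fun_prop) (by fun_prop))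
  have hmeas := key fun q => cdCoeff φ (q.1 + q.2 + 1).toNat q.1.toNat
  refine MemLp.of_bound hmeas.aestronglyMeasurable
    (∑ N ∈ Finset.range (⌊2 * t⌋.toNat + 2), ∑ m ∈ Finset.range (⌊2 * t⌋.toNat + 2),
      ‖cdCoeff φ N m‖) ?_
  filter_upwards [ae_restrict_mem measurableSet_Icc] with ξ hξ
  have h1 : 0 ≤ ⌊ξ + t⌋ := Int.floor_nonneg.2 (by linarith [hξ.1])
  have h2 : 0 ≤ ⌊t - ξ⌋ := Int.floor_nonneg.2 (by linarith [hξ.2])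
  have h3 : ⌊ξ + t⌋ + ⌊t - ξ⌋ ≤ ⌊2 * t⌋ := by
    refine (Int.le_floor_add _ _).trans (le_of_eq ?_)
    congr 1; ring
  refine (Finset.single_le_sum (f := fun m => ‖cdCoeff φ (⌊ξ + t⌋ + ⌊t - ξ⌋ + 1).toNat m‖)
    (fun _ _ => norm_nonneg _) (Finset.mem_range.2 ?_)).trans
    (Finset.single_le_sum (f := fun N => ∑ m ∈ Finset.range (⌊2 * t⌋.toNat + 2), ‖cdCoeff φ N m‖)
      (fun _ _ => by positivity) (Finset.mem_range.2 ?_)) <;> omega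

theorem toeplitzMoment_add (ρ : Measure ℝ) (a j l : ℕ) :
    toeplitzMoment ρ (a + j) (a + l) = toeplitzMoment ρ j l := by
  unfold toeplitzMoment
  push_cast
  simp only [add_sub_add_left_eq_sub]

/-- The points of the fibre in `[-t, t]` form a block of consecutive indices. Moments depend only on
index differences, so the block may be moved to start at `0`. The strict `t < M` keeps the block
inside the index range even for `ξ = 0` and `ξ = 1`. -/
theorem sum_toeplitzMoment_mul_kernelDensity {μ : Measure Circle} [IsFiniteMeasure μ]
    {φ : ℕ → Polynomial ℂ} (hφ : IsOrthonormalPolynomials μ φ) {t : ℝ} {M : ℕ} (hM : t < M)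
    {ξ : ℝ} (hξ : ξ ∈ Icc (0 : ℝ) 1) {l : ℕ} (hl : ξ + (l - M) ∈ Icc (-t) t) :
    ∑ i ∈ Finset.range (2 * M),
      toeplitzMoment (μ.map fun z : Circle => Complex.arg (z : ℂ)) i l *
        (Icc (-t) t).indicator (kernelDensity φ t) (ξ + (i - M)) =
      ((Real.sqrt (2 * Real.pi) : ℝ) : ℂ)⁻¹ := by
  -- `m` and `r` count the fibre points in `[-t, t]` to the left and right of the `l`-th.
  obtain ⟨m, hm⟩ := Int.eq_ofNat_of_zero_le
    (Int.floor_nonneg.2 (show 0 ≤ ξ + (l - M) + t by linarith [hl.1]))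
  obtain ⟨r, hr⟩ := Int.eq_ofNat_of_zero_le
    (Int.floor_nonneg.2 (show 0 ≤ t - (ξ + (l - M)) by linarith [hl.2]))
  have hm' := hm
  have hr' := hr
  rw [Int.floor_eq_iff] at hm' hr'
  push_cast at hm' hr'
  have hml : m ≤ l := by
    have : (m : ℝ) < l + 1 := by linarith [hm'.1, hξ.2]
    have : m < l + 1 := by exact_mod_cast this
    omega
  -- `a` is the index of the leftmost fibre point in `[-t, t]`.
  obtain ⟨a, rfl⟩ := Nat.exists_eq_add_of_le' hml
  push_cast at *
  have hupper : a + (m + r + 1) ≤ 2 * M := by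
    have : ((a + m + r : ℕ) : ℝ) < 2 * M := by push_cast; linarith [hr'.1, hξ.1]
    have : a + m + r < 2 * M := by exact_mod_cast this
    omega
  have hN : ∀ j : ℕ, j < m + r + 1 →
      (Icc (-t) t).indicator (kernelDensity φ t) (ξ + ((a + j : ℕ) - M)) =
        ((Real.sqrt (2 * Real.pi) : ℝ) : ℂ)⁻¹ * cdCoeff φ (m + r + 1) j := by
    intro j hj
    have hj' : (j : ℝ) ≤ m + r := by exact_mod_cast Nat.lt_succ_iff.1 hj
    have hj0 : (0 : ℝ) ≤ j := j.cast_nonneg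
    have hmem : ξ + ((a + j : ℕ) - M) ∈ Icc (-t) t :=
      ⟨by push_cast; linarith, by push_cast; linarith⟩
    rw [indicator_of_mem hmem, kernelDensity]
    have f1 : ⌊ξ + ((a + j : ℕ) - M) + t⌋ = j := by
      rw [Int.floor_eq_iff]; push_cast; constructor <;> linarith
    have f2 : ⌊t - (ξ + ((a + j : ℕ) - M))⌋ = m + r - j := by
      rw [Int.floor_eq_iff]; push_cast; constructor <;> linarith
    rw [f1, f2, show ((j : ℤ) + (m + r - j) + 1).toNat = m + r + 1 by omega, Int.toNat_natCast]
  have hsub : (Finset.range (m + r + 1)).map (addLeftEmbedding a) ⊆ Finset.range (2 * M) := by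
    intro i hi
    simp only [Finset.mem_map, Finset.mem_range, addLeftEmbedding_apply] at hi ⊢
    omega
  rw [← Finset.sum_subset hsub, Finset.sum_map]
  · have hs := hφ.sum_toeplitzMoment_mul_cdCoeff (N := m + r + 1) (m := m) (by omega)
    rw [← mul_one ((Real.sqrt (2 * Real.pi) : ℝ) : ℂ)⁻¹, ← hs, Finset.mul_sum]
    refine Finset.sum_congr rfl fun j hj => ?_
    rw [addLeftEmbedding_apply, hN j (Finset.mem_range.1 hj), add_comm a m, add_comm m a,
      toeplitzMoment_add]
    ring
  · intro i _ hi
    rw [indicator_of_notMem, mul_zero]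
    intro hmem
    apply hi
    have h1 : (a : ℝ) < i + 1 := by linarith [hmem.1]
    have h2 : (i : ℝ) < a + (m + r + 1) := by linarith [hmem.2]
    have h1' : a < i + 1 := by exact_mod_cast h1
    have h2' : i < a + (m + r + 1) := by exact_mod_cast h2
    simp only [Finset.mem_map, Finset.mem_range, addLeftEmbedding_apply]
    exact ⟨i - a, by omega, by omega⟩

theorem memLp_const_Icc (t : ℝ) (c : ℂ) :
    MemLp (fun _ : ℝ => c) 2 (volume.restrict (Icc (-t) t)) := memLp_const _

/-- The weak form of `L_{ν,t} k_t = sin(tz)/(πz)`, checked on each fibre; translates outside `[-t,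
t]` drop out because the data of the test function vanish there. -/
theorem linePairing_kernelDensity {μ : Measure Circle} [IsFiniteMeasure μ]
    {φ : ℕ → Polynomial ℂ} (hφ : IsOrthonormalPolynomials μ φ) {t : ℝ} {χ : ℝ → ℂ}
    (hχ : MemLp χ 2 (volume.restrict (Icc (-t) t))) :
    linePairing (periodization (μ.map fun z : Circle => Complex.arg (z : ℂ)))
        (pwTransform t (kernelDensity φ t)) (pwTransform t χ) =
      linePairing volume (pwTransform t fun _ => ((Real.sqrt (2 * Real.pi) : ℝ) : ℂ)⁻¹)
        (pwTransform t χ) := by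
  obtain ⟨M, hM⟩ := exists_nat_gt t
  have hc := memLp_const_Icc t ((Real.sqrt (2 * Real.pi) : ℝ) : ℂ)⁻¹
  rw [← periodization_restrict_Ioc, linePairing_periodization_eq_sum _ hM.le hc hχ,
    linePairing_periodization_eq_sum _ hM.le (memLp_kernelDensity φ t) hχ]
  refine intervalIntegral.integral_congr fun ξ hξ => ?_
  rw [uIcc_of_le zero_le_one] at hξ
  rw [Finset.sum_comm]
  conv_rhs => rw [Finset.sum_comm]
  refine Finset.sum_congr rfl fun l hl => ?_
  simp_rw [← mul_assoc]
  rw [← Finset.sum_mul, ← Finset.sum_mul]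
  by_cases h : ξ + (l - M) ∈ Icc (-t) t
  · rw [sum_toeplitzMoment_mul_kernelDensity hφ hM hξ h]
    simp only [toeplitzMoment_restrict_Ioc, ite_mul, one_mul, zero_mul, Finset.sum_ite_eq', hl,
      if_true, indicator_of_mem h]
  · rw [indicator_of_notMem h]; simp

theorem pwTransform_const (t : ℝ) (ht : 0 < t) :
    pwTransform t (fun _ => ((Real.sqrt (2 * Real.pi) : ℝ) : ℂ)⁻¹) = sincKernel t := by
  have hsq : ((Real.sqrt (2 * Real.pi) : ℝ) : ℂ)⁻¹ * ((Real.sqrt (2 * Real.pi) : ℝ) : ℂ)⁻¹ =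
      (2 * Real.pi : ℂ)⁻¹ := by
    rw [← mul_inv, ← Complex.ofReal_mul, Real.mul_self_sqrt (by positivity)]
    push_cast; rfl
  have hpi : (Real.pi : ℂ) ≠ 0 := Complex.ofReal_ne_zero.2 Real.pi_ne_zero
  funext z
  rw [pwTransform, integral_mul_const, mul_comm (∫ _ in _, _), ← mul_assoc, hsq,
    integral_Icc_eq_integral_Ioc, ← intervalIntegral.integral_of_le (by linarith), sincKernel]
  split_ifs with hz
  · subst hz
    simp
    field_simp
    ring
  · have hc : -Complex.I * z ≠ 0 := mul_ne_zero (neg_ne_zero.2 Complex.I_ne_zero) hz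
    have e : ∀ x : ℝ, Complex.exp (-Complex.I * x * z) = Complex.exp (-Complex.I * z * x) := by
      intro x; congr 1; ring
    simp_rw [e]
    rw [integral_exp_mul_complex hc, Complex.sin]
    have e1 : -Complex.I * z * (t : ℂ) = -(t * z) * Complex.I := by ring
    have e2 : -Complex.I * z * ((-t : ℝ) : ℂ) = (t * z) * Complex.I := by push_cast; ring
    rw [e1, e2]
    field_simp
    rw [Complex.I_sq]
    ring

theorem intervalIntegral_of_eq_const {w : ℝ → ℂ} {a b : ℝ} (hab : a ≤ b) {c : ℂ}
    (h : ∀ u ∈ Ioo a b, w u = c) :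
    IntervalIntegrable w volume a b ∧ ∫ u in a..b, w u = (b - a : ℝ) * c := by
  have hae : ∀ᵐ u ∂(volume.restrict (Ioc a b)), w u = c := by
    rw [← restrict_Ioo_eq_restrict_Ioc]
    filter_upwards [ae_restrict_mem measurableSet_Ioo] with u hu using h u hu
  constructor
  · rw [intervalIntegrable_iff_integrableOn_Ioc_of_le hab]
    exact (integrable_const c).congr (hae.mono fun u hu => hu.symm)
  · rw [intervalIntegral.integral_of_le hab, integral_congr_ae hae]
    simp [hab]

theorem pwTransform_kernelDensity_zero {μ : Measure Circle}
    {φ : ℕ → Polynomial ℂ} (hφ : IsOrthonormalPolynomials μ φ) {n : ℕ} {t : ℝ}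
    (ht : t ∈ Ioo ((n : ℝ) / 2) (((n : ℝ) + 1) / 2)) :
    pwTransform t (kernelDensity φ t) 0 = (2 * Real.pi : ℂ)⁻¹ *
      ((∑ k ∈ Finset.range n, ‖(φ k).eval 1‖ ^ 2 + (2 * t - n) * ‖(φ n).eval 1‖ ^ 2 : ℝ) : ℂ) := by
  have hsq : ((Real.sqrt (2 * Real.pi) : ℝ) : ℂ)⁻¹ * ((Real.sqrt (2 * Real.pi) : ℝ) : ℂ)⁻¹ =
      (2 * Real.pi : ℂ)⁻¹ := by
    rw [← mul_inv, ← Complex.ofReal_mul, Real.mul_self_sqrt (by positivity)]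
    push_cast; rfl
  -- With `u = ξ + t` in `[0, n + p]`, the fibre has `n + 1` points if the fractional part of `u` is
  -- in `(0, p)` and `n` points if it is in `(p, 1)`.
  obtain ⟨p, hp⟩ : ∃ p : ℝ, p = 2 * t - n := ⟨_, rfl⟩
  have hp0 : 0 < p := by linarith [ht.1]
  have hp1 : p < 1 := by linarith [ht.2]
  have htn : 2 * t = n + p := by linarith
  have hn0 : (0 : ℝ) ≤ n := n.cast_nonneg
  set w : ℝ → ℂ := fun u => cdCoeff φ (⌊u⌋ + ⌊2 * t - u⌋ + 1).toNat ⌊u⌋.toNat with hw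
  have e0 : pwTransform t (kernelDensity φ t) 0 =
      (2 * Real.pi : ℂ)⁻¹ * ∫ u in (0 : ℝ)..(n + p), w u := by
    simp only [pwTransform, mul_zero, Complex.exp_zero, one_mul, kernelDensity]
    rw [integral_const_mul, ← mul_assoc, hsq, integral_Icc_eq_integral_Ioc,
      ← intervalIntegral.integral_of_le (by linarith), ← htn]
    congr 1
    have := intervalIntegral.integral_comp_add_right (a := -t) (b := t) w t
    rw [show -t + t = 0 by ring, show t + t = 2 * t by ring] at this
    rw [← this]
    refine intervalIntegral.integral_congr fun ξ _ => ?_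
    simp only [hw]
    rw [show 2 * t - (ξ + t) = t - ξ by ring]
  have low : ∀ m : ℕ, m ≤ n → ∀ u ∈ Ioo (m : ℝ) (m + p), w u = cdCoeff φ (n + 1) m := by
    intro m hm u hu
    have f1 : ⌊u⌋ = m := by
      rw [Int.floor_eq_iff]; push_cast; constructor <;> linarith [hu.1, hu.2]
    have f2 : ⌊2 * t - u⌋ = n - m := by
      rw [Int.floor_eq_iff]; push_cast; constructor <;> linarith [hu.1, hu.2]
    simp only [hw, f1, f2]
    congr 1; omega
  have high : ∀ m : ℕ, m < n → ∀ u ∈ Ioo ((m : ℝ) + p) (m + 1), w u = cdCoeff φ n m := by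
    intro m hm u hu
    have f1 : ⌊u⌋ = m := by
      rw [Int.floor_eq_iff]; push_cast; constructor <;> linarith [hu.1, hu.2]
    have f2 : ⌊2 * t - u⌋ = n - m - 1 := by
      rw [Int.floor_eq_iff]; push_cast; constructor <;> linarith [hu.1, hu.2]
    simp only [hw, f1, f2]
    congr 1; omega
  have hlow := fun m hm => intervalIntegral_of_eq_const (by linarith) (low m hm)
  have hhigh := fun m hm => intervalIntegral_of_eq_const (by linarith) (high m hm)
  have hunit : ∀ m, m < n → IntervalIntegrable w volume (m : ℕ) (m + 1 : ℕ) := by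
    intro m hm
    push_cast
    exact (hlow m hm.le).1.trans (hhigh m hm).1
  have hsum := intervalIntegral.sum_integral_adjacent_intervals hunit
  have hpre : IntervalIntegrable w volume ((0 : ℕ) : ℝ) n :=
    IntervalIntegrable.trans_iterate hunit
  rw [Nat.cast_zero] at hsum hpre
  -- The last piece, from `n` to `n + p`, belongs entirely to fibres with `n + 1` points; it
  -- completes the sum of the `n + 1` coefficients.
  rw [e0, ← intervalIntegral.integral_add_adjacent_intervals hpre (hlow n le_rfl).1, ← hsum,
    (hlow n le_rfl).2]
  congr 1
  have hterm : ∀ m ∈ Finset.range n, ∫ u in (m : ℝ)..(m + 1 : ℕ), w u =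
      (p : ℂ) * cdCoeff φ (n + 1) m + (1 - p : ℂ) * cdCoeff φ n m := by
    intro m hm
    have hm' := Finset.mem_range.1 hm
    push_cast
    rw [← intervalIntegral.integral_add_adjacent_intervals (hlow m hm'.le).1 (hhigh m hm').1,
      (hlow m hm'.le).2, (hhigh m hm').2]
    push_cast; ring
  rw [Finset.sum_congr rfl hterm, Finset.sum_add_distrib, ← Finset.mul_sum, ← Finset.mul_sum,
    hφ.sum_cdCoeff n]
  have hlast := hφ.sum_cdCoeff (n + 1)
  rw [Finset.sum_range_succ, Finset.sum_range_succ] at hlast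
  rw [← hp, eq_sub_of_add_eq hlast]
  push_cast
  ring

/-! ### Linearity of the transform and the sampling inequalities -/

theorem pwTransform_congr_ae {t : ℝ} {ψ χ : ℝ → ℂ}
    (h : ψ =ᵐ[volume.restrict (Icc (-t) t)] χ) : pwTransform t ψ = pwTransform t χ := by
  funext z
  unfold pwTransform
  congr 1
  exact integral_congr_ae (h.mono fun ξ hξ => by simp only [hξ])

theorem pwTransform_smul (t : ℝ) (c : ℂ) (ψ : ℝ → ℂ) :
    pwTransform t (c • ψ) = c • pwTransform t ψ := by
  funext z
  simp only [pwTransform, Pi.smul_apply, smul_eq_mul, mul_left_comm _ c, integral_const_mul]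

theorem pwTransform_add {t : ℝ} {ψ χ : ℝ → ℂ}
    (hψ : MemLp ψ 2 (volume.restrict (Icc (-t) t)))
    (hχ : MemLp χ 2 (volume.restrict (Icc (-t) t))) :
    pwTransform t (ψ + χ) = pwTransform t ψ + pwTransform t χ := by
  have key : ∀ (ψ : ℝ → ℂ), MemLp ψ 2 (volume.restrict (Icc (-t) t)) → ∀ z : ℂ,
      IntegrableOn (fun ξ : ℝ => Complex.exp (-Complex.I * ξ * z) * ψ ξ) (Icc (-t) t) := by
    intro ψ hψ z
    have h1 : IntegrableOn ψ (Icc (-t) t) := hψ.integrable (by norm_num)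
    exact h1.continuousOn_mul (by fun_prop) isCompact_Icc
  funext z
  simp only [pwTransform, Pi.add_apply, mul_add]
  rw [integral_add (key ψ hψ z) (key χ hχ z), mul_add]

theorem pwTransform_mem {t : ℝ} {ψ : ℝ → ℂ} (hψ : MemLp ψ 2 (volume.restrict (Icc (-t) t))) :
    pwTransform t ψ ∈ paleyWiener t := ⟨ψ, hψ, fun _ => rfl⟩

theorem exists_eq_pwTransform {t : ℝ} {f : ℂ → ℂ} (hf : f ∈ paleyWiener t) :
    ∃ ψ, MemLp ψ 2 (volume.restrict (Icc (-t) t)) ∧ f = pwTransform t ψ := by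
  obtain ⟨ψ, hψ, h⟩ := hf
  exact ⟨ψ, hψ, funext h⟩

theorem integral_norm_sq_pwTransform_volume {t : ℝ} {ψ : ℝ → ℂ}
    (hψ : MemLp ψ 2 (volume.restrict (Icc (-t) t))) :
    ∫ x : ℝ, ‖pwTransform t ψ x‖ ^ 2 = ∫ ξ in Icc (-t) t, ‖ψ ξ‖ ^ 2 := by
  have h := integral_norm_sq_eq_linePairing volume (pwTransform t ψ)
  rw [linePairing_volume hψ hψ] at h
  simp only [Complex.mul_conj, Complex.normSq_eq_norm_sq] at h
  rw [integral_complex_ofReal] at h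
  exact_mod_cast h

/-- Coercivity integrated over the fibres. Padding every fibre by zeros to length `2M` makes one
constant serve all `ξ`. -/
theorem le_integral_norm_sq_pwTransform {μ : Measure Circle} [IsFiniteMeasure μ]
    {φ : ℕ → Polynomial ℂ} (hφ : IsOrthonormalPolynomials μ φ) (t : ℝ) :
    ∃ c : ℝ, 0 < c ∧ ∀ ψ : ℝ → ℂ, MemLp ψ 2 (volume.restrict (Icc (-t) t)) →
      c * ∫ ξ in Icc (-t) t, ‖ψ ξ‖ ^ 2 ≤ ∫ x : ℝ, ‖pwTransform t ψ x‖ ^ 2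
        ∂(periodization (μ.map fun z : Circle => Complex.arg (z : ℂ))) := by
  obtain ⟨M, hM⟩ := exists_nat_ge t
  obtain ⟨c, hc, hcoer⟩ := hφ.exists_coercive (2 * M)
  refine ⟨c, hc, fun ψ hψ => ?_⟩
  have m1 := (memLp_indicator_iff_restrict measurableSet_Icc).2 hψ
  have hsq : Integrable fun ξ => ‖(Icc (-t) t).indicator ψ ξ‖ ^ 2 :=
    m1.integrable_norm_pow (by norm_num)
  have e1 : ∫ ξ in Icc (-t) t, ‖ψ ξ‖ ^ 2 = ∫ ξ, ‖(Icc (-t) t).indicator ψ ξ‖ ^ 2 := by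
    rw [← integral_indicator measurableSet_Icc]
    congr 1; ext ξ
    by_cases h : ξ ∈ Icc (-t) t <;> simp [h]
  have hI : ∀ i l : ℕ, IntervalIntegrable (fun ξ : ℝ => (Icc (-t) t).indicator ψ (ξ + (i - M)) *
      conj ((Icc (-t) t).indicator ψ (ξ + (l - M)))) volume 0 1 := by
    intro i l
    rw [intervalIntegrable_iff_integrableOn_Ioc_of_le zero_le_one]
    exact (m1.comp_add_restrict _ _).integrable_mul (m1.comp_add_restrict _ _).star
  have hS : ∀ i : ℕ, IntervalIntegrable
      (fun ξ => ‖(Icc (-t) t).indicator ψ (ξ + (i - M))‖ ^ 2) volume 0 1 := by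
    intro i
    exact (hsq.comp_add_right _).intervalIntegrable
  have hG : IntervalIntegrable (fun ξ : ℝ => ∑ i ∈ Finset.range (2 * M), ∑ l ∈ Finset.range (2 * M),
      toeplitzMoment (μ.map fun z : Circle => Complex.arg (z : ℂ)) i l *
        ((Icc (-t) t).indicator ψ (ξ + (i - M)) *
          conj ((Icc (-t) t).indicator ψ (ξ + (l - M))))) volume 0 1 := by
    have := IntervalIntegrable.sum (Finset.range (2 * M)) fun i _ =>
      IntervalIntegrable.sum (Finset.range (2 * M)) fun l _ => (hI i l).const_mul
        (toeplitzMoment (μ.map fun z : Circle => Complex.arg (z : ℂ)) i l)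
    simpa only [Finset.sum_fn] using this
  have h := integral_norm_sq_eq_linePairing
    (periodization (μ.map fun z : Circle => Complex.arg (z : ℂ))) (pwTransform t ψ)
  rw [linePairing_periodization_eq_sum _ hM hψ hψ] at h
  have h' := congrArg Complex.re h
  rw [Complex.ofReal_re] at h'
  have hre := intervalIntegral.intervalIntegral_re (𝕜 := ℂ) hG
  simp only [RCLike.re_eq_complex_re] at hre
  rw [h', ← hre, e1, integral_eq_sum_shifts hsq hM (by intro ξ hξ; simp [hξ]),
    ← intervalIntegral.integral_finsetSum fun i _ => hS i, ← intervalIntegral.integral_const_mul]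
  refine intervalIntegral.integral_mono_on zero_le_one ?_ ?_ ?_
  · have := IntervalIntegrable.sum (Finset.range (2 * M)) fun i _ => hS i
    exact IntervalIntegrable.const_mul (by simpa only [Finset.sum_fn] using this) c
  · rw [intervalIntegrable_iff] at hG ⊢
    exact hG.re
  · intro ξ _
    exact hcoer fun i => (Icc (-t) t).indicator ψ (ξ + (i - M))

theorem MeasureTheory.MemLp.eLpNorm_two_eq {α : Type*} {m : MeasurableSpace α} {μ : Measure α}
    {f : α → ℂ} (hf : MemLp f 2 μ) :
    eLpNorm f 2 μ = ENNReal.ofReal (Real.sqrt (∫ x, ‖f x‖ ^ 2 ∂μ)) := by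
  rw [hf.eLpNorm_eq_integral_rpow_norm (by norm_num) (by norm_num)]
  congr 1
  rw [Real.sqrt_eq_rpow]
  norm_num

theorem memLp_pwTransform_volume {t : ℝ} {ψ : ℝ → ℂ}
    (hψ : MemLp ψ 2 (volume.restrict (Icc (-t) t))) :
    MemLp (fun x : ℝ => pwTransform t ψ x) 2 := by
  have := memLp_pwTransform (volume.restrict (Ioc (-Real.pi) Real.pi)) hψ
  rwa [periodization_restrict_Ioc] at this

theorem periodicMeasure_eq_periodization (μ : Measure Circle) :
    periodicMeasure μ = periodization (μ.map fun z : Circle => Complex.arg (z : ℂ)) := by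
  rw [periodicMeasure, periodization]
  congr 1; ext1 k
  exact (Measure.map_map (g := fun x : ℝ => x + 2 * Real.pi * k)
    (f := fun z : Circle => Complex.arg (z : ℂ)) (by fun_prop)
    (Complex.measurable_arg.comp Circle.continuous_coe.measurable)).symm

theorem IsOrthonormalPolynomials.isPWSampling {μ : Measure Circle} [IsFiniteMeasure μ]
    {φ : ℕ → Polynomial ℂ} (hφ : IsOrthonormalPolynomials μ φ) :
    IsPWSampling (periodicMeasure μ) := by
  intro t _
  rw [periodicMeasure_eq_periodization]
  obtain ⟨M, hM⟩ := exists_nat_ge t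
  obtain ⟨c, hc, hlow⟩ := le_integral_norm_sq_pwTransform hφ t
  set ρ := μ.map fun z : Circle => Complex.arg (z : ℂ) with hρ
  set K : ℝ := (2 * Real.pi)⁻¹ * (2 * M) * ρ.real univ with hK
  have hK0 : 0 ≤ K := by positivity
  have key : ∀ C a b : ℝ, 1 ≤ C → 0 ≤ b → a ≤ C * b →
      ENNReal.ofReal (Real.sqrt a) ≤ ENNReal.ofReal C * ENNReal.ofReal (Real.sqrt b) := by
    intro C a b hC hb hab
    rw [← ENNReal.ofReal_mul (by linarith)]
    refine ENNReal.ofReal_le_ofReal (Real.sqrt_le_iff.2 ⟨by positivity, ?_⟩)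
    rw [mul_pow, Real.sq_sqrt hb]
    nlinarith [mul_le_mul_of_nonneg_right (show C ≤ C ^ 2 by nlinarith) hb]
  have hc' : 0 < c⁻¹ := inv_pos.2 hc
  -- The available bounds compare squared norms. Since the constant is at least `1`, it is at most
  -- its square and so also serves for the norms.
  refine ⟨(1 + K + c⁻¹).toNNReal, by rw [Real.toNNReal_pos]; positivity, fun f hf => ?_⟩
  obtain ⟨ψ, hψ, rfl⟩ := exists_eq_pwTransform hf
  rw [(memLp_pwTransform ρ hψ).eLpNorm_two_eq, (memLp_pwTransform_volume hψ).eLpNorm_two_eq,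
    integral_norm_sq_pwTransform_volume hψ]
  have hup := integral_norm_sq_pwTransform_le ρ hM hψ
  have hlo := hlow ψ hψ
  have hA : 0 ≤ ∫ ξ in Icc (-t) t, ‖ψ ξ‖ ^ 2 := by positivity
  have hB : 0 ≤ ∫ x : ℝ, ‖pwTransform t ψ x‖ ^ 2 ∂(periodization ρ) := by positivity
  refine ⟨key _ _ _ (by linarith) hB ?_, key _ _ _ (by linarith) hA ?_⟩
  · have : ∫ ξ in Icc (-t) t, ‖ψ ξ‖ ^ 2 ≤
        c⁻¹ * ∫ x : ℝ, ‖pwTransform t ψ x‖ ^ 2 ∂(periodization ρ) := by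
      rwa [le_inv_mul_iff₀ hc]
    nlinarith [mul_nonneg hK0 hB]
  · rw [← hK] at hup
    nlinarith [mul_nonneg hc'.le hA]

/-! ### The truncated Toeplitz operator on `L²[-t, t]` -/

theorem MeasureTheory.Lp.norm_sq_eq_integral {α : Type*} {m : MeasurableSpace α} {μ : Measure α}
    (f : Lp ℂ 2 μ) : ‖f‖ ^ 2 = ∫ x, ‖f x‖ ^ 2 ∂μ := by
  rw [Lp.norm_def, (Lp.memLp f).eLpNorm_two_eq, ENNReal.toReal_ofReal (Real.sqrt_nonneg _),
    Real.sq_sqrt (by positivity)]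

/-- The Hilbert space `L²[-t, t]` is linearly isomorphic to the Paley–Wiener space. -/
noncomputable def paleyWienerEquiv (t : ℝ) :
    Lp ℂ 2 (volume.restrict (Icc (-t) t)) ≃ₗ[ℂ] paleyWiener t :=
  LinearEquiv.ofBijective
    { toFun := fun ψ : Lp ℂ 2 (volume.restrict (Icc (-t) t)) => ⟨pwTransform t ψ, pwTransform_mem (Lp.memLp ψ)⟩
      map_add' := fun ψ χ => Subtype.ext <|
        (pwTransform_congr_ae (Lp.coeFn_add ψ χ)).trans
          (pwTransform_add (Lp.memLp ψ) (Lp.memLp χ))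
      map_smul' := fun c ψ => Subtype.ext <|
        (pwTransform_congr_ae (Lp.coeFn_smul c ψ)).trans (pwTransform_smul t c ψ) }
    (by
      constructor
      · rw [← LinearMap.ker_eq_bot, LinearMap.ker_eq_bot']
        intro ψ h
        have h0 : pwTransform t ψ = 0 := congrArg Subtype.val h
        have h1 := integral_norm_sq_pwTransform_volume (Lp.memLp ψ)
        rw [h0, ← Lp.norm_sq_eq_integral] at h1
        simpa using h1.symm
      · rintro ⟨f, hf⟩
        obtain ⟨ψ, hψ, rfl⟩ := exists_eq_pwTransform hf
        exact ⟨hψ.toLp ψ, Subtype.ext (pwTransform_congr_ae hψ.coeFn_toLp)⟩)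

theorem coe_paleyWienerEquiv {t : ℝ} (ψ : Lp ℂ 2 (volume.restrict (Icc (-t) t))) :
    (paleyWienerEquiv t ψ : ℂ → ℂ) = pwTransform t ψ := rfl

theorem coe_paleyWienerEquiv_toLp {t : ℝ} {ψ : ℝ → ℂ}
    (hψ : MemLp ψ 2 (volume.restrict (Icc (-t) t))) :
    (paleyWienerEquiv t (hψ.toLp ψ) : ℂ → ℂ) = pwTransform t ψ :=
  pwTransform_congr_ae hψ.coeFn_toLp

theorem inner_eq_linePairing_volume {t : ℝ} (χ ψ : Lp ℂ 2 (volume.restrict (Icc (-t) t))) :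
    inner ℂ χ ψ = linePairing volume (paleyWienerEquiv t ψ) (paleyWienerEquiv t χ) := by
  rw [coe_paleyWienerEquiv, coe_paleyWienerEquiv, linePairing_volume (Lp.memLp ψ) (Lp.memLp χ),
    L2.inner_def]
  simp only [RCLike.inner_apply]

/-- The Fourier transform from `L²[-t, t]` to `L²` of the periodization of a finite measure. -/
noncomputable def pwRestriction (ρ : Measure ℝ) [IsFiniteMeasure ρ] (t : ℝ) :
    Lp ℂ 2 (volume.restrict (Icc (-t) t)) →L[ℂ] Lp ℂ 2 (periodization ρ) :=
  LinearMap.mkContinuous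
    { toFun := fun ψ : Lp ℂ 2 (volume.restrict (Icc (-t) t)) => (memLp_pwTransform ρ (Lp.memLp ψ)).toLp _
      map_add' := fun ψ χ => by
        rw [← MemLp.toLp_add, MemLp.toLp_eq_toLp_iff, pwTransform_congr_ae (Lp.coeFn_add ψ χ),
          pwTransform_add (Lp.memLp ψ) (Lp.memLp χ)]
        rfl
      map_smul' := fun c ψ => by
        rw [RingHom.id_apply, ← MemLp.toLp_const_smul, MemLp.toLp_eq_toLp_iff,
          pwTransform_congr_ae (Lp.coeFn_smul c ψ), pwTransform_smul]
        rfl }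
    (Real.sqrt ((2 * Real.pi)⁻¹ * (2 * ⌈t⌉₊) * ρ.real univ))
    (fun ψ => by
      refine (sq_le_sq₀ (norm_nonneg _) (by positivity)).1 ?_
      rw [mul_pow, Real.sq_sqrt (by positivity), Lp.norm_sq_eq_integral, Lp.norm_sq_eq_integral]
      refine le_trans (le_of_eq ?_)
        (integral_norm_sq_pwTransform_le ρ (Nat.le_ceil t) (Lp.memLp ψ))
      refine integral_congr_ae ?_
      filter_upwards [(memLp_pwTransform ρ (Lp.memLp ψ)).coeFn_toLp] with x hx
      exact congrArg (fun w : ℂ => ‖w‖ ^ 2) hx)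

theorem inner_pwRestriction (ρ : Measure ℝ) [IsFiniteMeasure ρ] {t : ℝ}
    (χ ψ : Lp ℂ 2 (volume.restrict (Icc (-t) t))) :
    inner ℂ (pwRestriction ρ t χ) (pwRestriction ρ t ψ) =
      linePairing (periodization ρ) (paleyWienerEquiv t ψ) (paleyWienerEquiv t χ) := by
  rw [L2.inner_def]
  refine integral_congr_ae ?_
  filter_upwards [(memLp_pwTransform ρ (Lp.memLp ψ)).coeFn_toLp,
    (memLp_pwTransform ρ (Lp.memLp χ)).coeFn_toLp] with x h1 h2
  rw [RCLike.inner_apply]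
  exact congrArg₂ (fun a b : ℂ => a * conj b) h1 h2

/-- If `R` maps Fourier data to `L²(ν)`, then `(R*Rψ, χ) = (Rψ, Rχ)` is the pairing against `ν`; so
`R*R`, transported to `PW_t`, is the operator sought. -/
theorem isTruncatedToeplitz_conj_adjoint (ρ : Measure ℝ) [IsFiniteMeasure ρ] (t : ℝ) :
    IsTruncatedToeplitz (periodization ρ) t ((paleyWienerEquiv t).conj
      ((pwRestriction ρ t).adjoint ∘L pwRestriction ρ t :
        Lp ℂ 2 (volume.restrict (Icc (-t) t)) →L[ℂ] Lp ℂ 2 (volume.restrict (Icc (-t) t)))) := by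
  refine ⟨fun f => ?_, fun f g => ?_⟩
  · obtain ⟨ψ, hψ, h⟩ := exists_eq_pwTransform f.2
    rw [h]
    exact memLp_pwTransform ρ hψ
  · obtain ⟨ψ, rfl⟩ := (paleyWienerEquiv t).surjective f
    obtain ⟨χ, rfl⟩ := (paleyWienerEquiv t).surjective g
    rw [LinearEquiv.conj_apply_apply, LinearEquiv.symm_apply_apply, ← inner_eq_linePairing_volume,
      ← inner_pwRestriction]
    exact (pwRestriction ρ t).adjoint_inner_right χ (pwRestriction ρ t ψ)

theorem IsTruncatedToeplitz.unique {ν : Measure ℝ} {t : ℝ}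
    {L L' : paleyWiener t →ₗ[ℂ] paleyWiener t} (h : IsTruncatedToeplitz ν t L)
    (h' : IsTruncatedToeplitz ν t L') : L = L' := by
  refine LinearMap.ext fun f => (paleyWienerEquiv t).symm.injective (ext_inner_left ℂ fun χ => ?_)
  rw [inner_eq_linePairing_volume, inner_eq_linePairing_volume, LinearEquiv.apply_symm_apply,
    LinearEquiv.apply_symm_apply, h.2, h'.2]

theorem IsTruncatedToeplitz.truncatedToeplitz_eq {ν : Measure ℝ} {t : ℝ}
    {L : paleyWiener t →ₗ[ℂ] paleyWiener t} (h : IsTruncatedToeplitz ν t L) :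
    truncatedToeplitz ν t = L := by
  have hex : ∃ L, IsTruncatedToeplitz ν t L := ⟨L, h⟩
  rw [truncatedToeplitz, dif_pos hex]
  exact hex.choose_spec.unique h

theorem isTruncatedToeplitz_truncatedToeplitz (μ : Measure Circle) [IsFiniteMeasure μ] (t : ℝ) :
    IsTruncatedToeplitz (periodicMeasure μ) t (truncatedToeplitz (periodicMeasure μ) t) := by
  have h := isTruncatedToeplitz_conj_adjoint (μ.map fun z : Circle => Complex.arg (z : ℂ)) t
  rwa [periodicMeasure_eq_periodization, h.truncatedToeplitz_eq]

/-! ### Invertibility, the kernel `k_t`, and rotations -/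

namespace IsOrthonormalPolynomials

variable {μ : Measure Circle} [IsFiniteMeasure μ] {φ : ℕ → Polynomial ℂ}

/-- The lower sampling inequality says that the form of `R*R` is coercive, so Lax–Milgram applies.
-/
theorem bijective_truncatedToeplitz (hφ : IsOrthonormalPolynomials μ φ) (t : ℝ) :
    Function.Bijective (truncatedToeplitz (periodicMeasure μ) t) := by
  have h := isTruncatedToeplitz_conj_adjoint (μ.map fun z : Circle => Complex.arg (z : ℂ)) t
  rw [periodicMeasure_eq_periodization, h.truncatedToeplitz_eq]
  set ρ := μ.map fun z : Circle => Complex.arg (z : ℂ) with hρ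
  obtain ⟨c, hc, hlow⟩ := le_integral_norm_sq_pwTransform hφ t
  have hunit : IsUnit ((pwRestriction ρ t).adjoint ∘L pwRestriction ρ t) := by
    refine ContinuousLinearMap.isUnit_of_forall_le_norm_inner_map _ (c := c.toNNReal)
      (Real.toNNReal_pos.2 hc) fun ψ => ?_
    rw [ContinuousLinearMap.comp_apply, ContinuousLinearMap.adjoint_inner_left,
      inner_pwRestriction, ← integral_norm_sq_eq_linePairing, Complex.norm_real,
      Real.norm_of_nonneg (by positivity), Lp.norm_sq_eq_integral, Real.coe_toNNReal _ hc.le,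
      mul_comm]
    exact hlow ψ (Lp.memLp ψ)
  have hb := (ContinuousLinearMap.isUnit_iff_bijective).1 hunit
  exact ((paleyWienerEquiv t).bijective.comp hb).comp (paleyWienerEquiv t).symm.bijective

theorem truncatedToeplitz_kernel (hφ : IsOrthonormalPolynomials μ φ) {t : ℝ} (ht : 0 < t) :
    (truncatedToeplitz (periodicMeasure μ) t
      (paleyWienerEquiv t ((memLp_kernelDensity φ t).toLp _)) : ℂ → ℂ) = sincKernel t := by
  rw [← pwTransform_const t ht, ← coe_paleyWienerEquiv_toLp (memLp_const_Icc t _)]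
  congr 1
  refine (paleyWienerEquiv t).symm.injective (ext_inner_left ℂ fun χ => ?_)
  rw [inner_eq_linePairing_volume, inner_eq_linePairing_volume, LinearEquiv.apply_symm_apply,
    LinearEquiv.apply_symm_apply, (isTruncatedToeplitz_truncatedToeplitz μ t).2,
    coe_paleyWienerEquiv_toLp, coe_paleyWienerEquiv_toLp, periodicMeasure_eq_periodization]
  exact linePairing_kernelDensity hφ (Lp.memLp χ)

/-- Injectivity forces `Function.invFun` to return the explicit solution. -/
theorem reproKernel_eq (hφ : IsOrthonormalPolynomials μ φ) {t : ℝ} (ht : 0 < t) :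
    reproKernel (periodicMeasure μ) t =
      paleyWienerEquiv t ((memLp_kernelDensity φ t).toLp _) := by
  rw [reproKernel, ← hφ.truncatedToeplitz_kernel ht]
  exact Function.leftInverse_invFun
    (Subtype.val_injective.comp (hφ.bijective_truncatedToeplitz t).1) _

theorem kernelsWellDefined (hφ : IsOrthonormalPolynomials μ φ) :
    KernelsWellDefined (periodicMeasure μ) := fun t ht =>
  ⟨isTruncatedToeplitz_truncatedToeplitz μ t, hφ.bijective_truncatedToeplitz t, by
    rw [hφ.reproKernel_eq ht, hφ.truncatedToeplitz_kernel ht]⟩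

theorem hasDerivAt_kernelAtZero (hφ : IsOrthonormalPolynomials μ φ) {n : ℕ} {t : ℝ}
    (ht : t ∈ Ioo ((n : ℝ) / 2) (((n : ℝ) + 1) / 2)) :
    HasDerivAt (kernelAtZero (periodicMeasure μ))
      ((Real.pi : ℂ)⁻¹ * ((‖(φ n).eval 1‖ ^ 2 : ℝ) : ℂ)) t := by
  have hn0 : (0 : ℝ) ≤ n := n.cast_nonneg
  have heq : kernelAtZero (periodicMeasure μ) =ᶠ[nhds t] fun s => (2 * Real.pi : ℂ)⁻¹ *
      ((∑ k ∈ Finset.range n, ‖(φ k).eval 1‖ ^ 2 + (2 * s - n) * ‖(φ n).eval 1‖ ^ 2 : ℝ) : ℂ) := by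
    filter_upwards [isOpen_Ioo.mem_nhds ht] with s hs
    rw [kernelAtZero, hφ.reproKernel_eq (by linarith [hs.1]), coe_paleyWienerEquiv_toLp,
      pwTransform_kernelDensity_zero hφ hs]
  refine HasDerivAt.congr_of_eventuallyEq ?_ heq
  have h1 : HasDerivAt (fun s : ℝ =>
      ∑ k ∈ Finset.range n, ‖(φ k).eval 1‖ ^ 2 + (2 * s - n) * ‖(φ n).eval 1‖ ^ 2)
      (2 * 1 * ‖(φ n).eval 1‖ ^ 2) t :=
    ((((hasDerivAt_id t).const_mul 2).sub_const _).mul_const _).const_add _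
  refine (h1.ofReal_comp.const_mul (2 * Real.pi : ℂ)⁻¹).congr_deriv ?_
  push_cast
  rw [mul_inv]
  ring

theorem differentiableAt_and_hFun (hφ : IsOrthonormalPolynomials μ φ) {n : ℕ} {t : ℝ}
    (ht : t ∈ Ioo ((n : ℝ) / 2) (((n : ℝ) + 1) / 2)) :
    DifferentiableAt ℝ (kernelAtZero (periodicMeasure μ)) t ∧
      hFun (periodicMeasure μ) t = ((‖(φ n).eval 1‖ ^ 2 : ℝ) : ℂ) := by
  have h := hφ.hasDerivAt_kernelAtZero ht
  refine ⟨h.differentiableAt, ?_⟩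
  rw [hFun, h.deriv, mul_inv_cancel_left₀ (Complex.ofReal_ne_zero.2 Real.pi_ne_zero)]

/-- Substituting `z ↦ ηz` in the polynomials undoes the rotation of the measure, and their value at
`1` becomes `φ_n(η)`. -/
theorem shift (hφ : IsOrthonormalPolynomials μ φ) (η : Circle) :
    IsOrthonormalPolynomials (shiftMeasure η μ)
      fun n => (φ n).comp (Polynomial.C (η : ℂ) * Polynomial.X) := by
  refine ⟨fun n => ?_, fun m n => ?_⟩
  · refine Polynomial.degree_eq_of_le_of_coeff_ne_zero ?_ ?_
    · rw [Polynomial.degree_le_iff_coeff_zero]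
      intro m hm
      rw [Polynomial.comp_C_mul_X_coeff, Polynomial.coeff_eq_zero_of_degree_lt, zero_mul]
      rwa [hφ.1]
    · rw [Polynomial.comp_C_mul_X_coeff]
      exact mul_ne_zero (Polynomial.coeff_ne_zero_of_eq_degree (hφ.1 n))
        (pow_ne_zero _ η.coe_ne_zero)
  · rw [shiftMeasure, integral_map (by fun_prop)
      (integrable_eval_mul_conj _ _ _).aestronglyMeasurable, ← hφ.2 m n]
    congr 2; ext z
    have : (η : ℂ) * ((η⁻¹ * z : Circle) : ℂ) = z := by
      rw [← Circle.coe_mul, mul_inv_cancel_left]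
    simp only [Polynomial.eval_comp, Polynomial.eval_mul, Polynomial.eval_C, Polynomial.eval_X,
      this]

end IsOrthonormalPolynomials

theorem mainTheorem11 (μ : Measure Circle) [IsFiniteMeasure μ] (hμ : μ.support.Infinite)
    (φ : ℕ → Polynomial ℂ) (hφ : IsOrthonormalPolynomials μ φ) :
    (IsPWSampling (periodicMeasure μ) ∧ KernelsWellDefined (periodicMeasure μ) ∧
      ∀ n : ℕ, ∀ t ∈ Ioo ((n : ℝ) / 2) (((n : ℝ) + 1) / 2),
        DifferentiableAt ℝ (kernelAtZero (periodicMeasure μ)) t ∧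
        hFun (periodicMeasure μ) t = ((‖(φ n).eval 1‖ ^ 2 : ℝ) : ℂ)) ∧
    ∀ η : Circle,
      IsPWSampling (periodicMeasure (shiftMeasure η μ)) ∧
      KernelsWellDefined (periodicMeasure (shiftMeasure η μ)) ∧
      ∀ n : ℕ, ∀ t ∈ Ioo ((n : ℝ) / 2) (((n : ℝ) + 1) / 2),
        DifferentiableAt ℝ (kernelAtZero (periodicMeasure (shiftMeasure η μ))) t ∧
        hFun (periodicMeasure (shiftMeasure η μ)) t =
          ((‖(φ n).eval (η : ℂ)‖ ^ 2 : ℝ) : ℂ) := by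
  refine ⟨⟨hφ.isPWSampling, hφ.kernelsWellDefined, fun n t ht => hφ.differentiableAt_and_hFun ht⟩,
    fun η => ?_⟩
  have : IsFiniteMeasure (shiftMeasure η μ) := by unfold shiftMeasure; infer_instance
  have hs := hφ.shift η
  refine ⟨hs.isPWSampling, hs.kernelsWellDefined, fun n t ht => ?_⟩
  have h := hs.differentiableAt_and_hFun ht
  simpa only [Polynomial.eval_comp, Polynomial.eval_mul, Polynomial.eval_C, Polynomial.eval_X,
    mul_one] using h
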